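/- Let $(M,\varphi,\zeta,\eta,g_M)$ be a Sasakian manifold with Levi-Civita connection $\nabla$: $\varphi$ is a $(1,1)$-tensor field, $\zeta$ a vector field, $\eta$ a $1$-form and $g_M$ a Riemannian metric with $$\varphi^2P=-P+\eta(P)\zeta,\quad \varphi\zeta=0,\quad \eta\circ\varphi=0,\quad \eta(\zeta)=1,\quad g_M(P,\zeta)=\eta(P),$$ $$g_M(\varphi P,\varphi Q)=g_M(P,Q)-\eta(P)\eta(Q),\quad g_M(\varphi P,Q)=-g_M(P,\varphi Q),$$ $$(\nabla_P\varphi)Q=g_M(P,Q)\zeta-\eta(Q)P,\quad \nabla_P\zeta=-\varphi P$$ for all vector fields $P,Q$. Let $(N,g_N)$ be a Riemannian manifold with $\dim N<\dim M$, and let $\Psi:M\to N$ be a semi-invariant conformal $\zeta^\perp$-Riemannian submersion with dilation $\lambda:M\to(0,\infty)$. This means that $\Psi$ is a smooth surjective submersion with $g_N(\Psi_*X,\Psi_*Y)=\lambda^2g_M(X,Y)$ for all $X,Y\in(\ker\Psi_*)^\perp$, that $\zeta$ is orthogonal to $\ker\Psi_*$, and that there is a smooth distribution $D_1\subseteq\ker\Psi_*$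 such that, with $D_2$ the orthogonal complement of $D_1$ in $\ker\Psi_*$, one has $\varphi(D_1)=D_1$ and $\varphi(D_2)\subseteq(\ker\Psi_*)^\perp$. Let $\mathcal V$ and $\mathcal H$ be the orthogonal projections onto $\ker\Psi_*$ and $(\ker\Psi_*)^\perp$. Let $\mu$ be the orthogonal complement of $\varphi D_2$ in $(\ker\Psi_*)^\perp$, and for $Z\in(\ker\Psi_*)^\perp$ write $\varphi Z=\alpha Z+\beta Z$ with $\alpha Z\in D_2$ and $\beta Z\in\mu$. Let $T_XY=\mathcal H\nabla_{\mathcal VX}\mathcal VY+\mathcal V\nabla_{\mathcal VX}\mathcal HY$ be O'Neill's tensor. Let $\nabla^\Psi$ be the pullback to $\Psi^{-1}TN$ of the Levi-Civita connection of $N$, and let $(\nabla\Psi_*)(X,Y)=\nabla^\Psi_X\Psi_*Y-\Psi_*(\nabla_XY)$ be the second fundamental form of $\Psi$. Then $D_2$ defines a totally geodesic foliation on $M$ (that is, $D_2$ is involutive and $\nabla_W\xi\in\Gamma(D_2)$ for all $W,\xi\in\Gamma(D_2)$) if and only if both of the following conditions hold: 1. $(\nabla\Psi_*)(W,\varphi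 U)\in\Gamma(\Psi_*\mu)$ for all $W\in\Gamma(D_2)$ and $U\in\Gamma(D_1)$; 2. for all $W,\xi\in\Gamma(D_2)$ and $Z\in\Gamma((\ker\Psi_*)^\perp)$, $$\frac1{\lambda^2}\,g_N\big(\nabla^\Psi_{\varphi\xi}\Psi_*\varphi W,\ \Psi_*\varphi\beta Z\big)=g_M(\varphi\xi,T_W\alpha Z)-g_M(W,\xi)\,g_M(\mathcal H\,\mathrm{grad}\ln\lambda,\ \varphi\beta Z)+\eta(\beta Z)\,g_M(W,\xi).$$ -/

import Mathlib

open Bundle FiberBundle VectorField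
open scoped Manifold ContDiff

noncomputable section

namespace SicSubmersion

section LeviCivita

variable {E : Type*} [NormedAddCommGroup E] [NormedSpace ℝ E]
  {M : Type*} [TopologicalSpace M] [ChartedSpace E M]
  [RiemannianBundle (fun x : M ↦ TangentSpace 𝓘(ℝ, E) x)]

/-- The right-hand side of Koszul's formula for `g(∇_X Y, Z)` at the point `x`. -/
def koszul [IsManifold 𝓘(ℝ, E) ∞ M] (Y X Z : Π x : M, TangentSpace 𝓘(ℝ, E) x) (x : M) : ℝ :=
  (d% (fun y ↦ inner ℝ (Y y) (Z y)) x (X x) + d% (fun y ↦ inner ℝ (X y) (Z y)) x (Y x)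
    - d% (fun y ↦ inner ℝ (X y) (Y y)) x (Z x)
    + inner ℝ (mlieBracket 𝓘(ℝ, E) X Y x) (Z x) - inner ℝ (mlieBracket 𝓘(ℝ, E) X Z x) (Y x)
    - inner ℝ (mlieBracket 𝓘(ℝ, E) Y Z x) (X x)) / 2

section Dual

variable [FiniteDimensional ℝ E]

instance tangentSpace_finiteDimensional (x : M) :
    FiniteDimensional ℝ (TangentSpace 𝓘(ℝ, E) x) :=
  inferInstanceAs (FiniteDimensional ℝ E)

/-- The vector dual to a covector with respect to the metric. -/
def sharp (x : M) : (TangentSpace 𝓘(ℝ, E) x →L[ℝ] ℝ) →L[ℝ] TangentSpace 𝓘(ℝ, E) x :=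
  haveI := FiniteDimensional.complete ℝ (TangentSpace 𝓘(ℝ, E) x)
  (InnerProductSpace.toDual ℝ
    (TangentSpace 𝓘(ℝ, E) x)).symm.toContinuousLinearEquiv.toContinuousLinearMap

theorem inner_sharp (x : M) (a : TangentSpace 𝓘(ℝ, E) x →L[ℝ] ℝ) (v : TangentSpace 𝓘(ℝ, E) x) :
    inner ℝ (sharp x a) v = a v := by
  have := FiniteDimensional.complete ℝ (TangentSpace 𝓘(ℝ, E) x)
  exact InnerProductSpace.toDual_symm_apply (𝕜 := ℝ) (E := TangentSpace 𝓘(ℝ, E) x)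

end Dual

variable [IsManifold 𝓘(ℝ, E) ∞ M]
  [IsContMDiffRiemannianBundle 𝓘(ℝ, E) ∞ E (fun x : M ↦ TangentSpace 𝓘(ℝ, E) x)]

theorem mdifferentiableAt_inner {X Y : Π x : M, TangentSpace 𝓘(ℝ, E) x} {x : M}
    (hX : MDiffAt (T% X) x) (hY : MDiffAt (T% Y) x) : MDiffAt (fun y ↦ inner ℝ (X y) (Y y)) x :=
  MDifferentiableAt.inner_bundle (E := fun x : M ↦ TangentSpace 𝓘(ℝ, E) x) hX hY

variable [FiniteDimensional ℝ E]

theorem koszul_tensorial_left {Y Z : Π x : M, TangentSpace 𝓘(ℝ, E) x} {x : M}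
    (hY : MDiffAt (T% Y) x) (hZ : MDiffAt (T% Z) x) :
    TensorialAt 𝓘(ℝ, E) E (koszul Y · Z x) x where
  smul {f X} hf hX := by
    have := FiniteDimensional.complete ℝ E
    have h1 := mvfderiv_mul hf (mdifferentiableAt_inner hX hZ)
    have h2 := mvfderiv_mul hf (mdifferentiableAt_inner hX hY)
    simp only [koszul, Pi.smul_apply', real_inner_smul_left, real_inner_smul_right]
    simp only [Pi.mul_def] at h1 h2
    rw [h1, h2, mlieBracket_smul_left hf hX, mlieBracket_smul_left hf hX]
    simp [inner_add_left, real_inner_smul_left]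
    ring
  add {X X'} hX hX' := by
    have := FiniteDimensional.complete ℝ E
    have h1 := mvfderiv_add (mdifferentiableAt_inner hX hZ) (mdifferentiableAt_inner hX' hZ)
    have h2 := mvfderiv_add (mdifferentiableAt_inner hX hY) (mdifferentiableAt_inner hX' hY)
    simp only [Pi.add_def] at h1 h2
    simp only [koszul, Pi.add_apply, inner_add_left, inner_add_right]
    rw [h1, h2, mlieBracket_add_left hX hX', mlieBracket_add_left hX hX']
    simp [inner_add_left]
    ring

theorem koszul_tensorial_right {Y X : Π x : M, TangentSpace 𝓘(ℝ, E) x} {x : M}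
    (hY : MDiffAt (T% Y) x) (hX : MDiffAt (T% X) x) :
    TensorialAt 𝓘(ℝ, E) E (koszul Y X · x) x where
  smul {f Z} hf hZ := by
    have := FiniteDimensional.complete ℝ E
    have h1 := mvfderiv_mul hf (mdifferentiableAt_inner hY hZ)
    have h2 := mvfderiv_mul hf (mdifferentiableAt_inner hX hZ)
    simp only [Pi.mul_def] at h1 h2
    simp only [koszul, Pi.smul_apply', real_inner_smul_right]
    rw [h1, h2, mlieBracket_smul_right hf hZ, mlieBracket_smul_right hf hZ]
    simp [inner_add_left, real_inner_smul_left]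
    rw [real_inner_comm (Z x) (X x), real_inner_comm (Z x) (Y x)]
    ring
  add {Z Z'} hZ hZ' := by
    have := FiniteDimensional.complete ℝ E
    have h1 := mvfderiv_add (mdifferentiableAt_inner hY hZ) (mdifferentiableAt_inner hY hZ')
    have h2 := mvfderiv_add (mdifferentiableAt_inner hX hZ) (mdifferentiableAt_inner hX hZ')
    simp only [Pi.add_def] at h1 h2
    simp only [koszul, Pi.add_apply, inner_add_right]
    rw [h1, h2, mlieBracket_add_right hZ hZ', mlieBracket_add_right hZ hZ']
    simp [inner_add_left]
    ring

open Classical in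
/-- The map underlying the Levi-Civita connection: `leviCivitaFun Y x` sends `X x` to the vector
whose inner product with `Z x` is given by Koszul's formula (and it is set to `0` if `Y` is not
differentiable at `x`). -/
def leviCivitaFun (Y : Π x : M, TangentSpace 𝓘(ℝ, E) x) (x : M) :
    TangentSpace 𝓘(ℝ, E) x →L[ℝ] TangentSpace 𝓘(ℝ, E) x :=
  if hY : MDiffAt (T% Y) x then
    sharp x ∘L TensorialAt.mkHom₂ (I := 𝓘(ℝ, E)) (F := E) (F' := E) (fun X Z ↦ koszul Y X Z x) x
      (fun _ hZ ↦ koszul_tensorial_left hY hZ) (fun _ hX ↦ koszul_tensorial_right hY hX)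
  else 0

theorem inner_leviCivitaFun {X Y Z : Π x : M, TangentSpace 𝓘(ℝ, E) x} {x : M}
    (hX : MDiffAt (T% X) x) (hY : MDiffAt (T% Y) x) (hZ : MDiffAt (T% Z) x) :
    inner ℝ (leviCivitaFun Y x (X x)) (Z x) = koszul Y X Z x := by
  rw [leviCivitaFun, dif_pos hY]
  simp only [ContinuousLinearMap.comp_apply, inner_sharp]
  exact TensorialAt.mkHom₂_apply _ _ hX hZ

theorem inner_leviCivitaFun_extend {Y : Π x : M, TangentSpace 𝓘(ℝ, E) x} {x : M}
    (hY : MDiffAt (T% Y) x) (u v : TangentSpace 𝓘(ℝ, E) x) :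
    inner ℝ (leviCivitaFun Y x u) v = koszul Y (extend E u) (extend E v) x := by
  simpa using inner_leviCivitaFun (mdifferentiableAt_extend 𝓘(ℝ, E) E u) hY
    (mdifferentiableAt_extend 𝓘(ℝ, E) E v)

variable (E M) in
/-- The Levi-Civita connection of the Riemannian metric, built from Koszul's formula.
The covariant derivative `∇_X Y` at `x` is `leviCivita E M Y x (X x)`. -/
def leviCivita : CovariantDerivative 𝓘(ℝ, E) E (fun x : M ↦ TangentSpace 𝓘(ℝ, E) x) where
  toFun := leviCivitaFun
  isCovariantDerivativeOnUniv :=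
    { add := by
        intro Y Y' x hY hY' _
        have := FiniteDimensional.complete ℝ E
        refine ContinuousLinearMap.ext fun u ↦ ext_inner_right ℝ fun v ↦ ?_
        have hu := mdifferentiableAt_extend 𝓘(ℝ, E) E u
        have hv := mdifferentiableAt_extend 𝓘(ℝ, E) E v
        rw [add_apply, inner_add_left, inner_leviCivitaFun_extend hY,
          inner_leviCivitaFun_extend hY', inner_leviCivitaFun_extend
            (mdifferentiableAt_add_section hY hY')]
        have h1 := mvfderiv_add (mdifferentiableAt_inner hY hv) (mdifferentiableAt_inner hY' hv)
        have h2 := mvfderiv_add (mdifferentiableAt_inner hu hY) (mdifferentiableAt_inner hu hY')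
        simp only [Pi.add_def] at h1 h2
        simp only [koszul, Pi.add_apply, inner_add_left, inner_add_right]
        rw [h1, h2, mlieBracket_add_right hY hY', mlieBracket_add_left hY hY']
        simp [inner_add_left]
        ring
      leibniz := by
        intro Y f x hY hf _
        have := FiniteDimensional.complete ℝ E
        refine ContinuousLinearMap.ext fun u ↦ ext_inner_right ℝ fun v ↦ ?_
        have hu := mdifferentiableAt_extend 𝓘(ℝ, E) E u
        have hv := mdifferentiableAt_extend 𝓘(ℝ, E) E v
        rw [add_apply, smul_apply, inner_add_left,
          real_inner_smul_left, inner_leviCivitaFun_extend hY,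
          inner_leviCivitaFun_extend (hf.smul_section hY)]
        have h1 := mvfderiv_mul hf (mdifferentiableAt_inner hY hv)
        have h2 := mvfderiv_mul hf (mdifferentiableAt_inner hu hY)
        simp only [Pi.mul_def] at h1 h2
        simp only [koszul, Pi.smul_apply', real_inner_smul_left, real_inner_smul_right]
        rw [h1, h2, mlieBracket_smul_right hf hY, mlieBracket_smul_left hf hY]
        simp [inner_add_left, real_inner_smul_left]
        rw [real_inner_comm (Y x) u]
        ring }

/-- The Levi-Civita connection is compatible with the metric. -/
theorem leviCivita_metric {Y Z : Π x : M, TangentSpace 𝓘(ℝ, E) x} {x : M}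
    (hY : MDiffAt (T% Y) x) (hZ : MDiffAt (T% Z) x) (u : TangentSpace 𝓘(ℝ, E) x) :
    d% (fun y ↦ inner ℝ (Y y) (Z y)) x u =
      inner ℝ (leviCivita E M Y x u) (Z x) + inner ℝ (Y x) (leviCivita E M Z x u) := by
  have := FiniteDimensional.complete ℝ E
  have hu := mdifferentiableAt_extend 𝓘(ℝ, E) E u
  have h1 := inner_leviCivitaFun hu hY hZ
  have h2 := inner_leviCivitaFun hu hZ hY
  rw [extend_apply_self] at h1 h2
  rw [real_inner_comm (leviCivita E M Z x u) (Y x)]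
  change _ = inner ℝ (leviCivitaFun Y x u) (Z x) + inner ℝ (leviCivitaFun Z x u) (Y x)
  have h3 : (fun y ↦ inner ℝ (Z y) (Y y)) = fun y ↦ inner ℝ (Y y) (Z y) := by
    funext y
    exact real_inner_comm _ _
  rw [h1, h2, koszul, koszul, h3, extend_apply_self,
    mlieBracket_swap_apply (I := 𝓘(ℝ, E)) (V := Z) (W := Y), inner_neg_left]
  ring

/-- The Levi-Civita connection is torsion-free. -/
theorem leviCivita_torsionFree {X Y : Π x : M, TangentSpace 𝓘(ℝ, E) x} {x : M}
    (hX : MDiffAt (T% X) x) (hY : MDiffAt (T% Y) x) :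
    leviCivita E M Y x (X x) - leviCivita E M X x (Y x) = mlieBracket 𝓘(ℝ, E) X Y x := by
  have := FiniteDimensional.complete ℝ E
  refine ext_inner_right ℝ fun v ↦ ?_
  have hv := mdifferentiableAt_extend 𝓘(ℝ, E) E v
  have h1 := inner_leviCivitaFun hX hY hv
  have h2 := inner_leviCivitaFun hY hX hv
  rw [extend_apply_self] at h1 h2
  rw [inner_sub_left]
  change inner ℝ (leviCivitaFun Y x (X x)) v - inner ℝ (leviCivitaFun X x (Y x)) v = _
  have h3 : (fun y ↦ inner ℝ (Y y) (X y)) = fun y ↦ inner ℝ (X y) (Y y) := by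
    funext y
    exact real_inner_comm _ _
  rw [h1, h2, koszul, koszul, h3, extend_apply_self,
    mlieBracket_swap_apply (I := 𝓘(ℝ, E)) (V := Y) (W := X), inner_neg_left]
  ring

end LeviCivita

section Geometry

variable {E : Type*} [NormedAddCommGroup E] [NormedSpace ℝ E]
  {M : Type*} [TopologicalSpace M] [ChartedSpace E M]

/-- Smooth vector fields. -/
def IsSmoothField [IsManifold 𝓘(ℝ, E) ∞ M] (X : Π x : M, TangentSpace 𝓘(ℝ, E) x) : Prop :=
  ContMDiff 𝓘(ℝ, E) 𝓘(ℝ, E).tangent ∞ (fun x ↦ (⟨x, X x⟩ : TangentBundle 𝓘(ℝ, E) M))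

/-- `X ∈ Γ(D)`: a smooth vector field with values in the distribution `D`. -/
def IsSection [IsManifold 𝓘(ℝ, E) ∞ M] (D : Π x : M, Submodule ℝ (TangentSpace 𝓘(ℝ, E) x))
    (X : Π x : M, TangentSpace 𝓘(ℝ, E) x) : Prop :=
  IsSmoothField X ∧ ∀ x, X x ∈ D x

/-- Smooth distributions: near each point, `D` has a smooth frame. -/
def IsSmoothDistribution [IsManifold 𝓘(ℝ, E) ∞ M]
    (D : Π x : M, Submodule ℝ (TangentSpace 𝓘(ℝ, E) x)) : Prop :=
  ∀ x : M, ∃ (U : Set M) (k : ℕ) (e : Fin k → Π y : M, TangentSpace 𝓘(ℝ, E) y),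
    IsOpen U ∧ x ∈ U ∧
    (∀ i, ContMDiffOn 𝓘(ℝ, E) 𝓘(ℝ, E).tangent ∞
      (fun y ↦ (⟨y, e i y⟩ : TangentBundle 𝓘(ℝ, E) M)) U) ∧
    ∀ y ∈ U, LinearIndependent ℝ (fun i ↦ e i y) ∧
      Submodule.span ℝ (Set.range fun i ↦ e i y) = D y

variable [FiniteDimensional ℝ E] [IsManifold 𝓘(ℝ, E) ∞ M]
  [RiemannianBundle (fun x : M ↦ TangentSpace 𝓘(ℝ, E) x)]

/-- The gradient of a function. -/
def grad (f : M → ℝ) (x : M) : TangentSpace 𝓘(ℝ, E) x := sharp x (d% f x)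

/-- An almost contact metric structure `(φ, ζ, η)` on the Riemannian manifold `M`. (The form `η` is
smooth because of `inner_reeb`.) -/
structure IsAlmostContactMetric (φ : Π x : M, TangentSpace 𝓘(ℝ, E) x →L[ℝ] TangentSpace 𝓘(ℝ, E) x)
    (ζ : Π x : M, TangentSpace 𝓘(ℝ, E) x) (η : Π x : M, TangentSpace 𝓘(ℝ, E) x →L[ℝ] ℝ) :
    Prop where
  smooth_phi : ContMDiff 𝓘(ℝ, E) (𝓘(ℝ, E).prod 𝓘(ℝ, E →L[ℝ] E)) ∞
    (fun x ↦ TotalSpace.mk' (E →L[ℝ] E)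
      (E := fun x : M ↦ TangentSpace 𝓘(ℝ, E) x →L[ℝ] TangentSpace 𝓘(ℝ, E) x) x (φ x))
  smooth_reeb : IsSmoothField ζ
  phi_phi : ∀ x (P : TangentSpace 𝓘(ℝ, E) x), φ x (φ x P) = -P + η x P • ζ x
  phi_reeb : ∀ x, φ x (ζ x) = 0
  eta_phi : ∀ x (P : TangentSpace 𝓘(ℝ, E) x), η x (φ x P) = 0
  eta_reeb : ∀ x, η x (ζ x) = 1
  inner_reeb : ∀ x (P : TangentSpace 𝓘(ℝ, E) x), inner ℝ P (ζ x) = η x P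
  inner_phi_phi : ∀ x (P Q : TangentSpace 𝓘(ℝ, E) x),
    inner ℝ (φ x P) (φ x Q) = inner ℝ P Q - η x P * η x Q
  inner_phi : ∀ x (P Q : TangentSpace 𝓘(ℝ, E) x), inner ℝ (φ x P) Q = -inner ℝ P (φ x Q)

variable [IsContMDiffRiemannianBundle 𝓘(ℝ, E) ∞ E (fun x : M ↦ TangentSpace 𝓘(ℝ, E) x)]

/-- `∇_X Y` for the Levi-Civita connection of `M`. -/
def nabla (X Y : Π x : M, TangentSpace 𝓘(ℝ, E) x) (x : M) : TangentSpace 𝓘(ℝ, E) x :=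
  leviCivita E M Y x (X x)

/-- A Sasakian structure: `(∇_P φ) Q = g(P, Q) ζ - η(Q) P` and `∇_P ζ = -φ P`, where
`(∇_P φ) Q = ∇_P (φ Q) - φ (∇_P Q)`. -/
structure IsSasakian (φ : Π x : M, TangentSpace 𝓘(ℝ, E) x →L[ℝ] TangentSpace 𝓘(ℝ, E) x)
    (ζ : Π x : M, TangentSpace 𝓘(ℝ, E) x) (η : Π x : M, TangentSpace 𝓘(ℝ, E) x →L[ℝ] ℝ) :
    Prop extends IsAlmostContactMetric φ ζ η where
  nabla_phi : ∀ P Q : Π x : M, TangentSpace 𝓘(ℝ, E) x, IsSmoothField P → IsSmoothField Q → ∀ x,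
    nabla P (fun y ↦ φ y (Q y)) x - φ x (nabla P Q x) =
      inner ℝ (P x) (Q x) • ζ x - η x (Q x) • P x
  nabla_reeb : ∀ P : Π x : M, TangentSpace 𝓘(ℝ, E) x, IsSmoothField P → ∀ x,
    nabla P ζ x = -φ x (P x)

/-- `D` defines a totally geodesic foliation: it is involutive (hence tangent to a foliation) and
the second fundamental forms of its leaves vanish, i.e. `∇_X Y ∈ Γ(D)` for all `X, Y ∈ Γ(D)`. -/
def DefinesTotallyGeodesicFoliation
    (D : Π x : M, Submodule ℝ (TangentSpace 𝓘(ℝ, E) x)) : Prop :=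
  (∀ X Y, IsSection D X → IsSection D Y → ∀ x, mlieBracket 𝓘(ℝ, E) X Y x ∈ D x) ∧
  (∀ X Y, IsSection D X → IsSection D Y → ∀ x, nabla X Y x ∈ D x)

end Geometry

section Submersion

variable {E : Type*} [NormedAddCommGroup E] [NormedSpace ℝ E] [FiniteDimensional ℝ E]
  {M : Type*} [TopologicalSpace M] [ChartedSpace E M] [IsManifold 𝓘(ℝ, E) ∞ M]
  [RiemannianBundle (fun x : M ↦ TangentSpace 𝓘(ℝ, E) x)]
  [IsContMDiffRiemannianBundle 𝓘(ℝ, E) ∞ E (fun x : M ↦ TangentSpace 𝓘(ℝ, E) x)]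
  {F : Type*} [NormedAddCommGroup F] [NormedSpace ℝ F] [FiniteDimensional ℝ F]
  {N : Type*} [TopologicalSpace N] [ChartedSpace F N] [IsManifold 𝓘(ℝ, F) ∞ N]
  [RiemannianBundle (fun y : N ↦ TangentSpace 𝓘(ℝ, F) y)]
  [IsContMDiffRiemannianBundle 𝓘(ℝ, F) ∞ F (fun y : N ↦ TangentSpace 𝓘(ℝ, F) y)]

variable (F)

/-- The differential `Ψ_*` at `x`. -/
abbrev push (Ψ : M → N) (x : M) : TangentSpace 𝓘(ℝ, E) x →L[ℝ] TangentSpace 𝓘(ℝ, F) (Ψ x) :=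
  mfderiv 𝓘(ℝ, E) 𝓘(ℝ, F) Ψ x

/-- The vertical distribution `ker Ψ_*`. -/
def vertical (Ψ : M → N) (x : M) : Submodule ℝ (TangentSpace 𝓘(ℝ, E) x) :=
  LinearMap.ker (push F Ψ x).toLinearMap

/-- The horizontal distribution `(ker Ψ_*)ᗮ`. -/
def horizontal (Ψ : M → N) (x : M) : Submodule ℝ (TangentSpace 𝓘(ℝ, E) x) :=
  (vertical F Ψ x)ᗮ

/-- The orthogonal projection `𝓥` onto the vertical distribution. -/
def vproj (Ψ : M → N) (x : M) : TangentSpace 𝓘(ℝ, E) x →L[ℝ] TangentSpace 𝓘(ℝ, E) x :=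
  (vertical F Ψ x).starProjection

/-- The orthogonal projection `𝓗` onto the horizontal distribution. -/
def hproj (Ψ : M → N) (x : M) : TangentSpace 𝓘(ℝ, E) x →L[ℝ] TangentSpace 𝓘(ℝ, E) x :=
  (horizontal F Ψ x).starProjection

/-- O'Neill's tensor `T_X Y = 𝓗 ∇_{𝓥X} 𝓥Y + 𝓥 ∇_{𝓥X} 𝓗Y`. -/
def oneillT (Ψ : M → N) (X Y : Π x : M, TangentSpace 𝓘(ℝ, E) x) (x : M) :
    TangentSpace 𝓘(ℝ, E) x :=
  hproj F Ψ x (nabla (fun y ↦ vproj F Ψ y (X y)) (fun y ↦ vproj F Ψ y (Y y)) x) +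
    vproj F Ψ x (nabla (fun y ↦ vproj F Ψ y (X y)) (fun y ↦ hproj F Ψ y (Y y)) x)

/-- The pullback connection `∇^Ψ_X σ` on the bundle `Ψ⁻¹TN`, at the point `x`. Let `e` be the
preferred local trivialization of `TN` around `Ψ x`, with coordinate frame `(e_i)`. If
`σ = ∑ σ^i (e_i ∘ Ψ)` near `x`, then
`∇^Ψ_X σ = ∑ dσ^i(X) e_i + ∑ σ^i(x) ∇^N_{Ψ_* X} e_i`. Here `extend F (σ x)` is the local field
`∑ σ^i(x) e_i`, with constant components in `e`. -/
def pullbackNabla (Ψ : M → N) (X : Π x : M, TangentSpace 𝓘(ℝ, E) x)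
    (σ : Π x : M, TangentSpace 𝓘(ℝ, F) (Ψ x)) (x : M) : TangentSpace 𝓘(ℝ, F) (Ψ x) :=
  let e := trivializationAt F (fun y : N ↦ TangentSpace 𝓘(ℝ, F) y) (Ψ x)
  e.symmL ℝ (Ψ x) (d% (fun y : M ↦ (e ⟨Ψ y, σ y⟩).2) x (X x)) +
    leviCivita F N (extend F (σ x)) (Ψ x) (push F Ψ x (X x))

/-- The second fundamental form `(∇Ψ_*)(X, Y) = ∇^Ψ_X (Ψ_* Y) - Ψ_* (∇_X Y)`. -/
def secondFundamentalForm (Ψ : M → N) (X Y : Π x : M, TangentSpace 𝓘(ℝ, E) x) (x : M) :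
    TangentSpace 𝓘(ℝ, F) (Ψ x) :=
  pullbackNabla F Ψ X (fun y ↦ push F Ψ y (Y y)) x - push F Ψ x (nabla X Y x)

variable (E) in
/-- Horizontally conformal submersions of `M` onto `N` with dilation `dil > 0`. -/
structure IsConformalSubmersion (Ψ : M → N) (dil : M → ℝ) : Prop where
  smooth : ContMDiff 𝓘(ℝ, E) 𝓘(ℝ, F) ∞ Ψ
  onto : Function.Surjective Ψ
  dim_lt : Module.finrank ℝ F < Module.finrank ℝ E
  maximal_rank : ∀ x, Function.Surjective (push (E := E) F Ψ x)
  dil_pos : ∀ x, 0 < dil x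
  conformal : ∀ x, ∀ u ∈ horizontal (E := E) F Ψ x, ∀ v ∈ horizontal (E := E) F Ψ x,
    inner ℝ (push (E := E) F Ψ x u) (push (E := E) F Ψ x v) = dil x ^ 2 * inner ℝ u v

/-- `D₂`, the orthogonal complement of `D₁` in `ker Ψ_*`. -/
def antiInvariant (Ψ : M → N) (D₁ : Π x : M, Submodule ℝ (TangentSpace 𝓘(ℝ, E) x)) (x : M) :
    Submodule ℝ (TangentSpace 𝓘(ℝ, E) x) :=
  vertical F Ψ x ⊓ (D₁ x)ᗮ

/-- `μ`, the orthogonal complement of `φ D₂` in `(ker Ψ_*)ᗮ`. -/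
def muDist (φ : Π x : M, TangentSpace 𝓘(ℝ, E) x →L[ℝ] TangentSpace 𝓘(ℝ, E) x) (Ψ : M → N)
    (D₁ : Π x : M, Submodule ℝ (TangentSpace 𝓘(ℝ, E) x)) (x : M) :
    Submodule ℝ (TangentSpace 𝓘(ℝ, E) x) :=
  horizontal F Ψ x ⊓ ((antiInvariant F Ψ D₁ x).map (φ x).toLinearMap)ᗮ

/-- Semi-invariant conformal `ζᗮ`-Riemannian submersions with dilation `dil`, and with invariant
distribution `D₁` (so that `ker Ψ_* = D₁ ⊕ D₂`). -/
structure IsSicReebPerpSubmersion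
    (φ : Π x : M, TangentSpace 𝓘(ℝ, E) x →L[ℝ] TangentSpace 𝓘(ℝ, E) x)
    (ζ : Π x : M, TangentSpace 𝓘(ℝ, E) x) (Ψ : M → N) (dil : M → ℝ)
    (D₁ : Π x : M, Submodule ℝ (TangentSpace 𝓘(ℝ, E) x)) : Prop
    extends IsConformalSubmersion E F Ψ dil where
  reeb_horizontal : ∀ x, ζ x ∈ horizontal F Ψ x
  smooth_D₁ : IsSmoothDistribution D₁
  D₁_le : ∀ x, D₁ x ≤ vertical F Ψ x
  map_D₁ : ∀ x, (D₁ x).map (φ x).toLinearMap = D₁ x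
  map_D₂ : ∀ x, (antiInvariant F Ψ D₁ x).map (φ x).toLinearMap ≤ horizontal F Ψ x

/-- `α Z`, the `D₂`-component of `φ Z`, for `Z` horizontal. -/
def alphaPart (φ : Π x : M, TangentSpace 𝓘(ℝ, E) x →L[ℝ] TangentSpace 𝓘(ℝ, E) x) (Ψ : M → N)
    (D₁ : Π x : M, Submodule ℝ (TangentSpace 𝓘(ℝ, E) x)) (Z : Π x : M, TangentSpace 𝓘(ℝ, E) x)
    (x : M) : TangentSpace 𝓘(ℝ, E) x :=
  (antiInvariant F Ψ D₁ x).starProjection (φ x (Z x))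

/-- `β Z`, the `μ`-component of `φ Z`, for `Z` horizontal. -/
def betaPart (φ : Π x : M, TangentSpace 𝓘(ℝ, E) x →L[ℝ] TangentSpace 𝓘(ℝ, E) x) (Ψ : M → N)
    (D₁ : Π x : M, Submodule ℝ (TangentSpace 𝓘(ℝ, E) x)) (Z : Π x : M, TangentSpace 𝓘(ℝ, E) x)
    (x : M) : TangentSpace 𝓘(ℝ, E) x :=
  (muDist F φ Ψ D₁ x).starProjection (φ x (Z x))

end Submersion

end SicSubmersion

end

open SicSubmersion

/-!
Write `D₂` for the anti-invariant distribution. As `∇_W ξ` (for `W, ξ ∈ Γ(D₂)`) lies in `D₂` exactly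
when its components along `D₁` and along the horizontal distribution vanish, the proof identifies
these components with the two conditions. The first is pointwise: modulo `Ψ_* μ`, the form
`(∇Ψ_*)(W, φ U)` only sees `⟨∇_W ξ, U⟩`. In the second, the Koszul formula for the conformal
submersion `Ψ` cancels the gradient of the dilation and leaves
`⟨∇_{φ ξ} W, β Z⟩ = ⟨φ ξ, T_W (α Z)⟩`, whereas
`⟨∇_W ξ, Z⟩ = -⟨φ ξ, T_W (α Z)⟩ - ⟨∇_W ξ, φ (β Z)⟩`.

It remains to compare `⟨∇_{φ ξ} W, Y⟩` with `⟨∇_W ξ, Y⟩` for `Y ∈ Γ(μ)` orthogonal to the Reeb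
field `ζ`. This uses the flow of `ζ`: since `ζ` is a Killing field, `L_ζ ∇ = 0`; since it is
horizontal and `Ψ` is conformal, the flow preserves `D₁` and `μ ∩ ζ^⊥` and rotates `D₂` into `φ D₂`,
infinitesimally `[ζ, W] = δ W + 2 φ W` and `[ζ, φ W] = φ (δ W) - 2 W` with `δ W ∈ Γ(D₂)`.
Differentiating along `ζ` the identity that one of the two forms vanishes on all sections therefore
yields the vanishing of the other one.
-/

namespace SicSubmersion

section Derivative

variable {E : Type*} [NormedAddCommGroup E] [NormedSpace ℝ E]
  {M : Type*} [TopologicalSpace M] [ChartedSpace E M]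
  {F : Type*} [NormedAddCommGroup F] [NormedSpace ℝ F]

theorem mvfderiv_congr {f g : M → F} {x : M} (h : f =ᶠ[nhds x] g) :
    mvfderiv 𝓘(ℝ, E) f x = mvfderiv 𝓘(ℝ, E) g x :=
  h.mfderiv_eq (I := 𝓘(ℝ, E)) (I' := 𝓘(ℝ, F))

theorem mvfderiv_clm_comp {G : Type*} [NormedAddCommGroup G] [NormedSpace ℝ G] (L : F →L[ℝ] G)
    {f : M → F} {x : M} (hf : MDiffAt f x) (v : TangentSpace 𝓘(ℝ, E) x) :
    d% (fun y ↦ L (f y)) x v = L (d% f x v) := by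
  have h := mfderiv_comp_apply (I := 𝓘(ℝ, E)) (I' := 𝓘(ℝ, F)) (I'' := 𝓘(ℝ, G)) x
    L.differentiableAt.mdifferentiableAt hf v
  rw [mfderiv_eq_fderiv, L.fderiv] at h
  exact h

variable [IsManifold 𝓘(ℝ, E) ∞ M]

theorem contMDiffAt_mfderiv_apply {N : Type*} [TopologicalSpace N] [ChartedSpace F N]
    [IsManifold 𝓘(ℝ, F) ∞ N] {m n : ℕ∞} {f : M → N} {x : M} (hf : CMDiffAt n f x)
    {X : Π x : M, TangentSpace 𝓘(ℝ, E) x} (hX : CMDiffAt m (T% X) x) (hmn : m + 1 ≤ n) :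
    ContMDiffAt 𝓘(ℝ, E) 𝓘(ℝ, F).tangent m
      (fun y ↦ (⟨f y, mfderiv 𝓘(ℝ, E) 𝓘(ℝ, F) f y (X y)⟩ : TangentBundle 𝓘(ℝ, F) N)) x := by
  have hmn' : (m : WithTop ℕ∞) + 1 ≤ n := mod_cast hmn
  have hn : (n : WithTop ℕ∞) ≤ ∞ := mod_cast le_top
  have : IsManifold 𝓘(ℝ, E) n M := .of_le hn
  have : IsManifold 𝓘(ℝ, F) n N := .of_le hn
  have : IsManifold 𝓘(ℝ, E) (m + 1) M := .of_le hmn'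
  have : IsManifold 𝓘(ℝ, F) (m + 1) N := .of_le hmn'
  exact (hf.mfderiv_const hmn').clm_apply_of_inCoordinates hX (hf.of_le (le_self_add.trans hmn'))

theorem mdifferentiableAt_mvfderiv_apply {f : M → F} {x : M} (hf : CMDiffAt 2 f x)
    {X : Π x : M, TangentSpace 𝓘(ℝ, E) x} (hX : CMDiffAt 1 (T% X) x) :
    MDiffAt (fun y ↦ d% f y (X y)) x := by
  have h := contMDiffAt_mfderiv_apply (m := 1) (n := 2) hf hX one_add_one_eq_two.le
  have h' := (contMDiffAt_totalSpace.1 h).2.mdifferentiableAt one_ne_zero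
  simp only [trivializationAt_model_space_apply] at h'
  exact h'

end Derivative

section LogDerivative

variable {E : Type*} [NormedAddCommGroup E] [NormedSpace ℝ E]
  {M : Type*} [TopologicalSpace M] [ChartedSpace E M] {f : M → ℝ} {x : M}

theorem mvfderiv_comp_hasDerivAt {g : ℝ → ℝ} {g' : ℝ} (hf : MDiffAt f x)
    (hg : HasDerivAt g g' (f x)) (v : TangentSpace 𝓘(ℝ, E) x) :
    d% (fun y ↦ g (f y)) x v = d% f x v * g' := by
  refine (mfderiv_comp_apply (I := 𝓘(ℝ, E)) (I' := 𝓘(ℝ, ℝ)) (I'' := 𝓘(ℝ, ℝ)) x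
    hg.differentiableAt.mdifferentiableAt hf v).trans ?_
  rw [mfderiv_eq_fderiv, hg.hasFDerivAt.fderiv]
  rfl

theorem mvfderiv_sq_eq_mul_mvfderiv_log (hf : MDiffAt (fun y ↦ f y ^ 2) x) (hfx : f x ≠ 0)
    (v : TangentSpace 𝓘(ℝ, E) x) :
    d% (fun y ↦ f y ^ 2) x v = 2 * f x ^ 2 * d% (fun y ↦ Real.log (f y)) x v := by
  have hchain := mvfderiv_comp_hasDerivAt hf
    ((Real.hasDerivAt_log (pow_ne_zero 2 hfx)).const_mul (1 / 2)) v
  have hlog : (fun y ↦ 1 / 2 * Real.log (f y ^ 2)) = fun y ↦ Real.log (f y) := by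
    funext y
    rw [Real.log_pow]
    push_cast
    ring
  rw [hlog] at hchain
  rw [hchain]
  field_simp

end LogDerivative

section Commutator

variable {E : Type*} [NormedAddCommGroup E] [NormedSpace ℝ E] [CompleteSpace E]
  {M : Type*} [TopologicalSpace M] [ChartedSpace E M] [IsManifold 𝓘(ℝ, E) ∞ M]
  {F : Type*} [NormedAddCommGroup F] [NormedSpace ℝ F]
  {X Y Z : Π x : M, TangentSpace 𝓘(ℝ, E) x} {x : M}

theorem contMDiffAt_mlieBracket {m n : ℕ∞} (hX : CMDiffAt n (T% X) x) (hY : CMDiffAt n (T% Y) x)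
    (hmn : m + 1 ≤ n) : CMDiffAt m (T% (mlieBracket 𝓘(ℝ, E) X Y)) x := by
  have : IsManifold 𝓘(ℝ, E) (minSmoothness ℝ 2) M := .of_le (n := ∞) <| by
    rw [minSmoothness_of_isRCLikeNormedField]
    exact WithTop.coe_le_coe.2 le_top
  have : IsManifold 𝓘(ℝ, E) (n + 1) M := .of_le (n := ∞) (mod_cast le_top)
  refine hX.mlieBracket_vectorField hY ?_
  rw [minSmoothness_of_isRCLikeNormedField]
  exact mod_cast hmn

theorem mlieBracket_jacobi (hX : CMDiffAt 2 (T% X) x) (hY : CMDiffAt 2 (T% Y) x)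
    (hZ : CMDiffAt 2 (T% Z) x) :
    mlieBracket 𝓘(ℝ, E) X (mlieBracket 𝓘(ℝ, E) Y Z) x =
      mlieBracket 𝓘(ℝ, E) (mlieBracket 𝓘(ℝ, E) X Y) Z x +
        mlieBracket 𝓘(ℝ, E) Y (mlieBracket 𝓘(ℝ, E) X Z) x := by
  have : IsManifold 𝓘(ℝ, E) (minSmoothness ℝ 3) M := .of_le (n := ∞) <| by
    rw [minSmoothness_of_isRCLikeNormedField]
    exact WithTop.coe_le_coe.2 le_top
  rw [← minSmoothness_of_isRCLikeNormedField (𝕜 := ℝ) (n := 2)] at hX hY hZ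
  exact leibniz_identity_mlieBracket_apply hX hY hZ

theorem mlieBracket_mlieBracket_smul {f : M → ℝ} (hf : CMDiffAt 2 f x)
    (hY : CMDiffAt 2 (T% Y) x) (hZ : CMDiffAt 2 (T% Z) x) :
    mlieBracket 𝓘(ℝ, E) X (mlieBracket 𝓘(ℝ, E) Y (f • Z)) x =
      d% (fun y ↦ d% f y (Y y)) x (X x) • Z x
        + d% f x (Y x) • mlieBracket 𝓘(ℝ, E) X Z x
        + d% f x (X x) • mlieBracket 𝓘(ℝ, E) Y Z x
        + f x • mlieBracket 𝓘(ℝ, E) X (mlieBracket 𝓘(ℝ, E) Y Z) x := by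
  have hdf : MDiffAt f x := hf.mdifferentiableAt two_ne_zero
  have hdZ : MDiffAt (T% Z) x := hZ.mdifferentiableAt two_ne_zero
  have hYf : MDiffAt (fun y ↦ d% f y (Y y)) x :=
    mdifferentiableAt_mvfderiv_apply hf (hY.of_le one_le_two)
  have hYZ : MDiffAt (T% (mlieBracket 𝓘(ℝ, E) Y Z)) x :=
    (contMDiffAt_mlieBracket (m := 1) (n := 2) hY hZ one_add_one_eq_two.le).mdifferentiableAt
      one_ne_zero
  have hexpand : mlieBracket 𝓘(ℝ, E) Y (f • Z) =ᶠ[nhds x]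
      (fun y ↦ d% f y (Y y)) • Z + f • mlieBracket 𝓘(ℝ, E) Y Z := by
    filter_upwards [(contMDiffAt_iff_contMDiffAt_nhds (by simp)).1 hf,
      (contMDiffAt_iff_contMDiffAt_nhds (by simp)).1 hZ] with y hfy hZy
    exact mlieBracket_smul_right (hfy.mdifferentiableAt two_ne_zero)
      (hZy.mdifferentiableAt two_ne_zero)
  rw [Filter.EventuallyEq.rfl.mlieBracket_vectorField_eq hexpand,
    mlieBracket_add_right (hYf.smul_section hdZ) (hdf.smul_section hYZ),
    mlieBracket_smul_right hYf hdZ, mlieBracket_smul_right hdf hYZ]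
  abel

/- Expand the Jacobi identity of `X`, `Y` and `f • Z`, for a field `Z` that does not vanish at `x`,
and compare the coefficients of `Z x`. -/
theorem mvfderiv_mlieBracket_real {f : M → ℝ} (hf : CMDiffAt 2 f x)
    (hX : CMDiffAt 2 (T% X) x) (hY : CMDiffAt 2 (T% Y) x) :
    d% f x (mlieBracket 𝓘(ℝ, E) X Y x) =
      d% (fun y ↦ d% f y (Y y)) x (X x) - d% (fun y ↦ d% f y (X y)) x (Y x) := by
  rcases subsingleton_or_nontrivial (TangentSpace 𝓘(ℝ, E) x) with h | h
  · simp [Subsingleton.elim (X x) 0, Subsingleton.elim (Y x) 0,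
      Subsingleton.elim (mlieBracket 𝓘(ℝ, E) X Y x) 0]
  obtain ⟨v, hv⟩ := exists_ne (0 : TangentSpace 𝓘(ℝ, E) x)
  set Z : Π y : M, TangentSpace 𝓘(ℝ, E) y := extend E v
  have hZ : CMDiffAt 2 (T% Z) x := contMDiffAt_extend 𝓘(ℝ, E) E v
  have hfZ : CMDiffAt 2 (T% (f • Z)) x := hf.smul_section hZ
  have h := mlieBracket_jacobi hX hY hfZ
  rw [mlieBracket_mlieBracket_smul hf hY hZ,
    mlieBracket_mlieBracket_smul hf hX hZ,
    mlieBracket_smul_right (hf.mdifferentiableAt two_ne_zero)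
      (hZ.mdifferentiableAt two_ne_zero), mlieBracket_jacobi hX hY hZ] at h
  have hcoeff : (d% (fun y ↦ d% f y (Y y)) x (X x) - d% (fun y ↦ d% f y (X y)) x (Y x)
      - d% f x (mlieBracket 𝓘(ℝ, E) X Y x)) • Z x = 0 := by
    linear_combination (norm := module) h
  rw [show Z x = v from extend_apply_self E v, smul_eq_zero_iff_left hv] at hcoeff
  linarith

theorem mvfderiv_mlieBracket {f : M → F} (hf : CMDiffAt 2 f x)
    (hX : CMDiffAt 2 (T% X) x) (hY : CMDiffAt 2 (T% Y) x) :
    d% f x (mlieBracket 𝓘(ℝ, E) X Y x) =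
      d% (fun y ↦ d% f y (Y y)) x (X x) - d% (fun y ↦ d% f y (X y)) x (Y x) := by
  refine (SeparatingDual.eq_iff_forall_dual_eq (R := ℝ)).2 fun L ↦ ?_
  have hdf : ∀ᶠ y in nhds x, MDiffAt f y := by
    filter_upwards [(contMDiffAt_iff_contMDiffAt_nhds (by simp)).1 hf] with y hy
    exact hy.mdifferentiableAt two_ne_zero
  have hL {Z : Π y : M, TangentSpace 𝓘(ℝ, E) y} (hZ : CMDiffAt 2 (T% Z) x)
      (v : TangentSpace 𝓘(ℝ, E) x) :
      d% (fun y ↦ d% (fun z ↦ L (f z)) y (Z y)) x v = L (d% (fun y ↦ d% f y (Z y)) x v) := by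
    rw [← mvfderiv_clm_comp L (mdifferentiableAt_mvfderiv_apply hf (hZ.of_le one_le_two))]
    have : (fun y ↦ d% (fun z ↦ L (f z)) y (Z y)) =ᶠ[nhds x] fun y ↦ L (d% f y (Z y)) := by
      filter_upwards [hdf] with y hy using mvfderiv_clm_comp L hy _
    rw [mvfderiv_congr this]
  have hLf : CMDiffAt 2 (fun y ↦ L (f y)) x := L.contMDiff.contMDiffAt.comp x hf
  rw [← mvfderiv_clm_comp L hdf.self_of_nhds, mvfderiv_mlieBracket_real hLf hX hY, hL hX, hL hY,
    map_sub]

end Commutator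

section ProductRule

variable {E : Type*} [NormedAddCommGroup E] [NormedSpace ℝ E]
  {M : Type*} [TopologicalSpace M] [ChartedSpace E M]
  {F : Type*} [NormedAddCommGroup F] [NormedSpace ℝ F]
  {G : Type*} [NormedAddCommGroup G] [NormedSpace ℝ G] {x : M}

theorem mvfderiv_clm_apply {L : M → F →L[ℝ] G} {a : M → F} (hL : MDiffAt L x) (ha : MDiffAt a x)
    (v : TangentSpace 𝓘(ℝ, E) x) :
    d% (fun y ↦ L y (a y)) x v = d% (fun y ↦ L y (a x)) x v + L x (d% a x v) := by
  have heval := isBoundedBilinearMap_apply (𝕜 := ℝ) (E := F) (F := G) |>.hasFDerivAt (L x, a x)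
  have hpair : HasMFDerivAt 𝓘(ℝ, E) 𝓘(ℝ, (F →L[ℝ] G) × F) (fun y ↦ (L y, a y)) x
      ((d% L x).prod (d% a x)) :=
    ⟨hL.continuousAt.prodMk ha.continuousAt, hL.hasMFDerivAt.2.prodMk ha.hasMFDerivAt.2⟩
  have heval_left : d% (fun y ↦ L y (a x)) x v = d% L x v (a x) :=
    mvfderiv_clm_comp (ContinuousLinearMap.apply ℝ G (a x)) hL v
  rw [heval_left, add_comm]
  exact DFunLike.congr_fun (heval.hasMFDerivAt.comp x hpair).mfderiv v

theorem mdifferentiableAt_of_forall_clm_apply [FiniteDimensional ℝ F] {L : M → F →L[ℝ] G}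
    (h : ∀ w, MDiffAt (fun y ↦ L y w) x) : MDiffAt L x := by
  let b := Module.finBasis ℝ F
  let coord i : F →L[ℝ] ℝ := LinearMap.toContinuousLinearMap (b.coord i)
  have hL : L = ∑ i, fun y ↦ (ContinuousLinearMap.smulRightL ℝ F G (coord i)) (L y (b i)) := by
    ext y w
    suffices L y w = ∑ i, b.repr w i • L y (b i) by simpa [coord] using this
    simp only [← map_smul, ← map_sum, b.sum_repr]
  rw [hL]
  exact MDifferentiableAt.sum fun i _ ↦
    (ContinuousLinearMap.differentiableAt _).mdifferentiableAt.comp x (h (b i))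

end ProductRule

section CoordinateFields

variable {F : Type*} [NormedAddCommGroup F] [NormedSpace ℝ F]
  {N : Type*} [TopologicalSpace N] [ChartedSpace F N] [IsManifold 𝓘(ℝ, F) ∞ N]

theorem mvfderiv_extChartAt {p q : N} (hq : q ∈ (chartAt F p).source)
    (v : TangentSpace 𝓘(ℝ, F) q) :
    d% (extChartAt 𝓘(ℝ, F) p) q v = (trivializationAt F (TangentSpace 𝓘(ℝ, F)) p ⟨q, v⟩).2 := by
  have hq' : q ∈ (trivializationAt F (TangentSpace 𝓘(ℝ, F)) p).baseSet := by simpa using hq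
  have h1 : d% (extChartAt 𝓘(ℝ, F) p) q v =
      (trivializationAt F (TangentSpace 𝓘(ℝ, F)) p).continuousLinearMapAt ℝ q v := by
    rw [TangentBundle.continuousLinearMapAt_trivializationAt (I := 𝓘(ℝ, F)) hq]
    rfl
  rw [h1, Trivialization.continuousLinearMapAt_apply, Trivialization.linearMapAt_apply,
    if_pos hq']

theorem trivializationAt_extend {p q : N} (v : TangentSpace 𝓘(ℝ, F) p)
    (hq : q ∈ (chartAt F p).source) :
    (trivializationAt F (TangentSpace 𝓘(ℝ, F)) p ⟨q, extend F v q⟩).2 =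
      (trivializationAt F (TangentSpace 𝓘(ℝ, F)) p ⟨p, v⟩).2 := by
  have hq' : q ∈ (trivializationAt F (TangentSpace 𝓘(ℝ, F)) p).baseSet := by simpa using hq
  rw [extend, Trivialization.apply_mk_symm _ hq']

theorem mlieBracket_extend [CompleteSpace F] (p : N) (v w : TangentSpace 𝓘(ℝ, F) p) :
    mlieBracket 𝓘(ℝ, F) (extend F v) (extend F w) p = 0 := by
  have key : ∀ u : TangentSpace 𝓘(ℝ, F) p,
      d% (fun q ↦ d% (extChartAt 𝓘(ℝ, F) p) q (extend F u q)) p = 0 := by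
    intro u
    have h : (fun q ↦ d% (extChartAt 𝓘(ℝ, F) p) q (extend F u q)) =ᶠ[nhds p]
        fun _ ↦ (trivializationAt F (TangentSpace 𝓘(ℝ, F)) p ⟨p, u⟩).2 := by
      filter_upwards [chart_source_mem_nhds F p] with q hq
      rw [mvfderiv_extChartAt hq, trivializationAt_extend u hq]
    rw [mvfderiv_congr h, mvfderiv_const]
  have h := mvfderiv_mlieBracket (contMDiffAt_extChartAt (I := 𝓘(ℝ, F)) (x := p) (n := 2))
    (contMDiffAt_extend 𝓘(ℝ, F) F v) (contMDiffAt_extend 𝓘(ℝ, F) F w)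
  rw [key, key] at h
  have h1 : d% (extChartAt 𝓘(ℝ, F) p) p (mlieBracket 𝓘(ℝ, F) (extend F v) (extend F w) p) =
      mlieBracket 𝓘(ℝ, F) (extend F v) (extend F w) p :=
    congrArg (fun L : F →L[ℝ] F ↦ L _) (mfderiv_extChartAt_self (I := 𝓘(ℝ, F)) (x := p))
  rw [h1] at h
  exact h.trans (sub_self (0 : F))

theorem extend_eq_symmL {p q : N} (hq : q ∈ (chartAt F p).source) (v : TangentSpace 𝓘(ℝ, F) p) :
    (extend F v q : TangentSpace 𝓘(ℝ, F) q) =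
      (trivializationAt F (TangentSpace 𝓘(ℝ, F)) p).symmL ℝ q
        ((trivializationAt F (TangentSpace 𝓘(ℝ, F)) p).continuousLinearMapAt ℝ p v) := by
  have hq' : q ∈ (trivializationAt F (TangentSpace 𝓘(ℝ, F)) p).baseSet := by simpa using hq
  rw [Trivialization.continuousLinearMapAt_apply, Trivialization.linearMapAt_apply,
    if_pos (mem_baseSet_trivializationAt' p), Trivialization.symmL_apply _ hq', extend]

theorem symmL_eq_extend {p q : N} (hq : q ∈ (chartAt F p).source) (a : F) :
    (trivializationAt F (TangentSpace 𝓘(ℝ, F)) p).symmL ℝ q a =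
      extend F ((trivializationAt F (TangentSpace 𝓘(ℝ, F)) p).symmL ℝ p a) q := by
  rw [extend_eq_symmL hq, Trivialization.continuousLinearMapAt_symmL _
    (mem_baseSet_trivializationAt' p)]

variable [RiemannianBundle (fun y : N ↦ TangentSpace 𝓘(ℝ, F) y)]
  [IsContMDiffRiemannianBundle 𝓘(ℝ, F) ∞ F (fun y : N ↦ TangentSpace 𝓘(ℝ, F) y)]
  [FiniteDimensional ℝ F]

theorem leviCivita_extend_comm (p : N) (v w : TangentSpace 𝓘(ℝ, F) p) :
    leviCivita F N (extend F v) p w = leviCivita F N (extend F w) p v := by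
  have := FiniteDimensional.complete ℝ F
  have h := leviCivita_torsionFree (mdifferentiableAt_extend 𝓘(ℝ, F) F w)
    (mdifferentiableAt_extend 𝓘(ℝ, F) F v)
  rwa [mlieBracket_extend, extend_apply_self, extend_apply_self, sub_eq_zero] at h

end CoordinateFields

section PullbackConnection

variable {E : Type*} [NormedAddCommGroup E] [NormedSpace ℝ E]
  {M : Type*} [TopologicalSpace M] [ChartedSpace E M]
  {F : Type*} [NormedAddCommGroup F] [NormedSpace ℝ F]
  {N : Type*} [TopologicalSpace N] [ChartedSpace F N] [IsManifold 𝓘(ℝ, F) ∞ N]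
  [RiemannianBundle (fun y : N ↦ TangentSpace 𝓘(ℝ, F) y)]
  [IsContMDiffRiemannianBundle 𝓘(ℝ, F) ∞ F (fun y : N ↦ TangentSpace 𝓘(ℝ, F) y)]

theorem mdifferentiableAt_inner_along {Ψ : M → N} {x : M}
    {σ τ : Π x : M, TangentSpace 𝓘(ℝ, F) (Ψ x)}
    (hσ : MDiffAt (fun y ↦ (⟨Ψ y, σ y⟩ : TangentBundle 𝓘(ℝ, F) N)) x)
    (hτ : MDiffAt (fun y ↦ (⟨Ψ y, τ y⟩ : TangentBundle 𝓘(ℝ, F) N)) x) :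
    MDiffAt (fun y ↦ inner ℝ (σ y) (τ y)) x :=
  MDifferentiableAt.inner_bundle (E := fun q : N ↦ TangentSpace 𝓘(ℝ, F) q) hσ hτ

variable [FiniteDimensional ℝ F]

theorem mvfderiv_inner_eq_extend_add {Ψ : M → N} {x : M}
    {σ τ : Π x : M, TangentSpace 𝓘(ℝ, F) (Ψ x)}
    (hσ : MDiffAt (fun y ↦ (⟨Ψ y, σ y⟩ : TangentBundle 𝓘(ℝ, F) N)) x)
    (hτ : MDiffAt (fun y ↦ (⟨Ψ y, τ y⟩ : TangentBundle 𝓘(ℝ, F) N)) x)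
    (v : TangentSpace 𝓘(ℝ, E) x) :
    d% (fun y ↦ inner ℝ (σ y) (τ y)) x v =
      d% (fun y ↦ inner ℝ (σ y) (extend F (τ x) (Ψ y))) x v +
        inner ℝ (σ x) ((trivializationAt F (TangentSpace 𝓘(ℝ, F)) (Ψ x)).symmL ℝ (Ψ x)
          (d% (fun y ↦ (trivializationAt F (TangentSpace 𝓘(ℝ, F)) (Ψ x) ⟨Ψ y, τ y⟩).2) x v)) := by
  have hΨ : MDiffAt Ψ x := ((mdifferentiableAt_totalSpace _ _).1 hσ).1
  set e := trivializationAt F (TangentSpace 𝓘(ℝ, F)) (Ψ x)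
  let L (y : M) : F →L[ℝ] ℝ := innerSL ℝ (σ y) ∘L e.symmL ℝ (Ψ y)
  have hsource : ∀ᶠ y in nhds x, Ψ y ∈ (chartAt F (Ψ x)).source :=
    hΨ.continuousAt.preimage_mem_nhds (chart_source_mem_nhds F (Ψ x))
  have hL : MDiffAt L x := mdifferentiableAt_of_forall_clm_apply fun a ↦ by
    have hext : MDiffAt (fun y ↦ (⟨Ψ y, extend F (e.symmL ℝ (Ψ x) a) (Ψ y)⟩ :
        TangentBundle 𝓘(ℝ, F) N)) x := (mdifferentiableAt_extend 𝓘(ℝ, F) F _).comp x hΨ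
    refine (mdifferentiableAt_inner_along hσ hext).congr_of_eventuallyEq ?_
    filter_upwards [hsource] with y hy
    simp [L, e, symmL_eq_extend hy]
  have ha : MDiffAt (fun y ↦ (e ⟨Ψ y, τ y⟩).2) x := ((mdifferentiableAt_totalSpace _ _).1 hτ).2
  have hcoord : (fun y ↦ inner ℝ (σ y) (τ y)) =ᶠ[nhds x] fun y ↦ L y (e ⟨Ψ y, τ y⟩).2 := by
    filter_upwards [hsource] with y hy
    have hy' : Ψ y ∈ e.baseSet := by simpa [e] using hy
    simp [L, e.symmL_apply hy', e.symm_apply_apply_mk hy']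
  have hconst : (fun y ↦ inner ℝ (σ y) (extend F (τ x) (Ψ y))) =ᶠ[nhds x]
      fun y ↦ L y (e ⟨Ψ x, τ x⟩).2 := by
    filter_upwards [hsource] with y hy
    have hx : Ψ x ∈ e.baseSet := mem_baseSet_trivializationAt' (Ψ x)
    simp [L, e, symmL_eq_extend hy, e.symmL_apply hx, e.symm_apply_apply_mk hx]
  rw [mvfderiv_congr hcoord, mvfderiv_congr hconst, mvfderiv_clm_apply hL ha]
  rfl

theorem pullbackNabla_metric {Ψ : M → N} {x : M}
    {σ τ : Π x : M, TangentSpace 𝓘(ℝ, F) (Ψ x)}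
    (hσ : MDiffAt (fun y ↦ (⟨Ψ y, σ y⟩ : TangentBundle 𝓘(ℝ, F) N)) x)
    (hτ : MDiffAt (fun y ↦ (⟨Ψ y, τ y⟩ : TangentBundle 𝓘(ℝ, F) N)) x)
    (X : Π x : M, TangentSpace 𝓘(ℝ, E) x) :
    d% (fun y ↦ inner ℝ (σ y) (τ y)) x (X x) =
      inner ℝ (pullbackNabla F Ψ X σ x) (τ x) + inner ℝ (σ x) (pullbackNabla F Ψ X τ x) := by
  have hΨ : MDiffAt Ψ x := ((mdifferentiableAt_totalSpace _ _).1 hσ).1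
  have hext (v : TangentSpace 𝓘(ℝ, F) (Ψ x)) :
      MDiffAt (fun y ↦ (⟨Ψ y, extend F v (Ψ y)⟩ : TangentBundle 𝓘(ℝ, F) N)) x :=
    (mdifferentiableAt_extend 𝓘(ℝ, F) F v).comp x hΨ
  have hLC := leviCivita_metric (mdifferentiableAt_extend 𝓘(ℝ, F) F (σ x))
    (mdifferentiableAt_extend 𝓘(ℝ, F) F (τ x)) (push F Ψ x (X x))
  have hchain := mvfderiv_comp_apply x (mdifferentiableAt_inner
    (mdifferentiableAt_extend 𝓘(ℝ, F) F (τ x)) (mdifferentiableAt_extend 𝓘(ℝ, F) F (σ x))) hΨ (X x)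
  simp only [Function.comp_def] at hchain
  rw [mvfderiv_inner_eq_extend_add hσ hτ]
  simp only [real_inner_comm _ (σ _)]
  rw [mvfderiv_inner_eq_extend_add (hext _) hσ, hchain]
  simp only [real_inner_comm _ (extend F (τ x) _)]
  rw [hLC]
  simp only [extend_apply_self, pullbackNabla, inner_add_left, real_inner_comm _ (σ x)]
  ring

theorem pullbackNabla_zero {Ψ : M → N} {x : M} (hΨ : MDiffAt Ψ x)
    (X : Π x : M, TangentSpace 𝓘(ℝ, E) x) : pullbackNabla F Ψ X (fun _ ↦ 0) x = 0 := by
  refine ext_inner_right ℝ fun v ↦ ?_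
  have hzero : MDiffAt (fun y ↦ (⟨Ψ y, 0⟩ : TangentBundle 𝓘(ℝ, F) N)) x :=
    ((contMDiff_zeroSection ℝ (TangentSpace 𝓘(ℝ, F) (M := N))).mdifferentiable
      one_ne_zero).mdifferentiableAt.comp x hΨ
  have hext : MDiffAt (fun y ↦ (⟨Ψ y, extend F v (Ψ y)⟩ : TangentBundle 𝓘(ℝ, F) N)) x :=
    (mdifferentiableAt_extend 𝓘(ℝ, F) F v).comp x hΨ
  have h := pullbackNabla_metric hzero hext X
  simpa [mvfderiv_const] using h.symm

variable [IsManifold 𝓘(ℝ, E) ∞ M] [CompleteSpace E]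

theorem pullbackNabla_torsionFree {Ψ : M → N} {x : M} (hΨ : ContMDiffAt 𝓘(ℝ, E) 𝓘(ℝ, F) 2 Ψ x)
    {X Y : Π x : M, TangentSpace 𝓘(ℝ, E) x} (hX : CMDiffAt 2 (T% X) x) (hY : CMDiffAt 2 (T% Y) x) :
    pullbackNabla F Ψ X (fun y ↦ push F Ψ y (Y y)) x -
      pullbackNabla F Ψ Y (fun y ↦ push F Ψ y (X y)) x =
        push F Ψ x (mlieBracket 𝓘(ℝ, E) X Y x) := by
  have hev : ∀ᶠ y in nhds x, MDiffAt Ψ y ∧ Ψ y ∈ (chartAt F (Ψ x)).source := by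
    refine .and ?_ (hΨ.continuousAt.preimage_mem_nhds (chart_source_mem_nhds F (Ψ x)))
    filter_upwards [(contMDiffAt_iff_contMDiffAt_nhds (by simp)).1 hΨ] with y hy
    exact hy.mdifferentiableAt (by simp)
  set f : M → F := fun y ↦ extChartAt 𝓘(ℝ, F) (Ψ x) (Ψ y)
  have hpush : ∀ᶠ y in nhds x, ∀ v : TangentSpace 𝓘(ℝ, E) y,
      (trivializationAt F (TangentSpace 𝓘(ℝ, F)) (Ψ x) ⟨Ψ y, push F Ψ y v⟩).2 = d% f y v := by
    filter_upwards [hev] with y hy v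
    rw [← mvfderiv_extChartAt hy.2]
    exact (mfderiv_comp_apply y (mdifferentiableAt_extChartAt hy.2) hy.1 v).symm
  have hcoord : ∀ Z : Π x : M, TangentSpace 𝓘(ℝ, E) x,
      d% (fun y : M ↦ (trivializationAt F (TangentSpace 𝓘(ℝ, F)) (Ψ x)
        ⟨Ψ y, push F Ψ y (Z y)⟩).2) x = d% (fun y ↦ d% f y (Z y)) x := by
    intro Z
    refine mvfderiv_congr ?_
    filter_upwards [hpush] with y hy
    exact hy _
  have hf2 : ContMDiffAt 𝓘(ℝ, E) 𝓘(ℝ, F) 2 f x :=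
    (contMDiffAt_extChartAt (I := 𝓘(ℝ, F)) (x := Ψ x) (n := 2)).comp x hΨ
  simp only [pullbackNabla]
  rw [hcoord, hcoord, leviCivita_extend_comm, add_sub_add_right_eq_sub,
    ← map_sub, ← mvfderiv_mlieBracket hf2 hX hY, ← hpush.self_of_nhds,
    Trivialization.symmL_apply _ (mem_baseSet_trivializationAt' (Ψ x)),
    Trivialization.symm_apply_apply_mk _ (mem_baseSet_trivializationAt' (Ψ x))]

end PullbackConnection

section SmoothFields

variable {E : Type*} [NormedAddCommGroup E] [NormedSpace ℝ E]
  {M : Type*} [TopologicalSpace M] [ChartedSpace E M] [IsManifold 𝓘(ℝ, E) ∞ M]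
  {X Y : Π x : M, TangentSpace 𝓘(ℝ, E) x}

theorem exists_isSmoothField_apply_eq [FiniteDimensional ℝ E] [T2Space M] {x : M}
    (v : TangentSpace 𝓘(ℝ, E) x) :
    ∃ X : Π x : M, TangentSpace 𝓘(ℝ, E) x, IsSmoothField X ∧ X x = v := by
  obtain ⟨s, hs, hsv⟩ := exists_contMDiffOn_extend (k := ∞) 𝓘(ℝ, E) E v
  obtain ⟨u, hus, hu, hxu⟩ := mem_nhds_iff.1 hs
  obtain ⟨f, -, hf⟩ := (SmoothBumpFunction.nhds_basis_tsupport (I := 𝓘(ℝ, E)) x).mem_iff.1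
    (hu.mem_nhds hxu)
  refine ⟨(f : M → ℝ) • extend E v, ?_, by simp⟩
  exact ContMDiffOn.smul_section_of_tsupport f.contMDiff.contMDiffOn hu hf (hsv.mono hus)

theorem IsSmoothField.mdifferentiableAt (hX : IsSmoothField X) (x : M) : MDiffAt (T% X) x :=
  (hX x).mdifferentiableAt (by simp)

theorem IsSmoothField.contMDiffAt_two (hX : IsSmoothField X) (x : M) : CMDiffAt 2 (T% X) x :=
  (hX x).of_le (WithTop.coe_le_coe.2 le_top)

theorem IsSmoothField.sub (hX : IsSmoothField X) (hY : IsSmoothField Y) :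
    IsSmoothField (fun x ↦ X x - Y x) :=
  ContMDiff.sub_section hX hY

theorem IsSmoothField.const_smul (c : ℝ) (hX : IsSmoothField X) :
    IsSmoothField (fun x ↦ c • X x) :=
  ContMDiff.const_smul_section (a := c) hX

theorem IsSmoothField.mlieBracket [CompleteSpace E] (hX : IsSmoothField X)
    (hY : IsSmoothField Y) : IsSmoothField (mlieBracket 𝓘(ℝ, E) X Y) :=
  fun x ↦ contMDiffAt_mlieBracket (m := ⊤) (n := ⊤) (hX x) (hY x) le_top

theorem IsSmoothField.clm_apply {φ : Π x : M, TangentSpace 𝓘(ℝ, E) x →L[ℝ] TangentSpace 𝓘(ℝ, E) x}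
    (hφ : ContMDiff 𝓘(ℝ, E) (𝓘(ℝ, E).prod 𝓘(ℝ, E →L[ℝ] E)) ∞
      (fun x ↦ TotalSpace.mk' (E →L[ℝ] E)
        (E := fun x : M ↦ TangentSpace 𝓘(ℝ, E) x →L[ℝ] TangentSpace 𝓘(ℝ, E) x) x (φ x)))
    (hX : IsSmoothField X) : IsSmoothField (fun x ↦ φ x (X x)) :=
  ContMDiff.clm_bundle_apply (F₁ := E) (F₂ := E) (b := fun x : M ↦ x) hφ hX

theorem IsSmoothField.inner [RiemannianBundle (fun x : M ↦ TangentSpace 𝓘(ℝ, E) x)]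
    [IsContMDiffRiemannianBundle 𝓘(ℝ, E) ∞ E (fun x : M ↦ TangentSpace 𝓘(ℝ, E) x)]
    (hX : IsSmoothField X) (hY : IsSmoothField Y) : CMDiff ∞ (fun x ↦ inner ℝ (X x) (Y x)) :=
  ContMDiff.inner_bundle (E := fun x : M ↦ TangentSpace 𝓘(ℝ, E) x) hX hY

end SmoothFields

section GramSchmidt

open Submodule InnerProductSpace

theorem sum_inner_div_smul_eq_of_mem_span {V : Type*} [NormedAddCommGroup V]
    [InnerProductSpace ℝ V] {ι : Type*} [Fintype ι] {f : ι → V}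
    (hf : Pairwise fun i j ↦ inner ℝ (f i) (f j) = 0) {v : V} (hv : v ∈ span ℝ (Set.range f)) :
    ∑ i, (inner ℝ (f i) v / inner ℝ (f i) (f i)) • f i = v := by
  obtain ⟨c, rfl⟩ := (mem_span_range_iff_exists_fun ℝ).1 hv
  refine Finset.sum_congr rfl fun i _ ↦ ?_
  have hi : inner ℝ (f i) (∑ j, c j • f j) = c i * inner ℝ (f i) (f i) := by
    rw [inner_sum, Finset.sum_eq_single_of_mem i (Finset.mem_univ i), real_inner_smul_right]
    exact fun j _ hj ↦ by rw [real_inner_smul_right, hf hj.symm, mul_zero]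
  by_cases h0 : f i = 0
  · simp [h0]
  · rw [hi, mul_div_cancel_right₀ _ (inner_self_ne_zero.2 h0)]

variable {E : Type*} [NormedAddCommGroup E] [NormedSpace ℝ E]
  {M : Type*} [TopologicalSpace M] [ChartedSpace E M] [IsManifold 𝓘(ℝ, E) ∞ M]
  [RiemannianBundle (fun x : M ↦ TangentSpace 𝓘(ℝ, E) x)]
  [IsContMDiffRiemannianBundle 𝓘(ℝ, E) ∞ E (fun x : M ↦ TangentSpace 𝓘(ℝ, E) x)]
  {ι : Type*} [LinearOrder ι] [LocallyFiniteOrderBot ι] [WellFoundedLT ι]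
  {e : ι → Π y : M, TangentSpace 𝓘(ℝ, E) y} {x : M}

theorem contMDiffAt_inner_div_smul {V W : Π y : M, TangentSpace 𝓘(ℝ, E) y}
    (hV : CMDiffAt ∞ (T% V) x) (hVx : V x ≠ 0)
    (hVW : CMDiffAt ∞ (fun y ↦ inner ℝ (V y) (W y)) x) :
    CMDiffAt ∞ (T% (fun y ↦ (inner ℝ (V y) (W y) / inner ℝ (V y) (V y)) • V y)) x :=
  (hVW.div₀ (ContMDiffAt.inner_bundle (E := fun x : M ↦ TangentSpace 𝓘(ℝ, E) x) hV hV)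
    (inner_self_ne_zero.2 hVx)).smul_section hV

theorem contMDiffAt_gramSchmidt
    (he : ∀ i, CMDiffAt ∞ (T% (e i)) x) (hli : LinearIndependent ℝ (fun i ↦ e i x)) (i : ι) :
    CMDiffAt ∞ (T% (fun y ↦ gramSchmidt ℝ (fun j ↦ e j y) i)) x := by
  induction i using WellFoundedLT.induction with
  | ind i ih =>
    simp only [gramSchmidt_def ℝ _ i, starProjection_singleton, RCLike.ofReal_real_eq_id, id,
      ← real_inner_self_eq_norm_sq]
    refine (he i).sub_section (ContMDiffAt.sum_section fun j hj ↦ ?_)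
    have hsmooth := ih j (Finset.mem_Iio.1 hj)
    exact contMDiffAt_inner_div_smul hsmooth (gramSchmidt_ne_zero j hli)
      (ContMDiffAt.inner_bundle (E := fun x : M ↦ TangentSpace 𝓘(ℝ, E) x) hsmooth (he i))

theorem contMDiffAt_of_inner_frame [Finite ι] (he : ∀ i, CMDiffAt ∞ (T% (e i)) x)
    (hli : LinearIndependent ℝ (fun i ↦ e i x)) {Z : Π y : M, TangentSpace 𝓘(ℝ, E) y}
    (hZ : ∀ᶠ y in nhds x, Z y ∈ span ℝ (Set.range fun i ↦ e i y))
    (hinner : ∀ W : Π y : M, TangentSpace 𝓘(ℝ, E) y, CMDiffAt ∞ (T% W) x →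
      (∀ y, W y ∈ span ℝ (Set.range fun i ↦ e i y)) →
        CMDiffAt ∞ (fun y ↦ inner ℝ (W y) (Z y)) x) :
    CMDiffAt ∞ (T% Z) x := by
  have := Fintype.ofFinite ι
  let f i (y : M) := gramSchmidt ℝ (fun j ↦ e j y) i
  have hspan y : span ℝ (Set.range fun i ↦ f i y) = span ℝ (Set.range fun i ↦ e i y) :=
    span_gramSchmidt ℝ fun j ↦ e j y
  have hf i : CMDiffAt ∞ (T% (f i)) x := contMDiffAt_gramSchmidt he hli i
  have hfZ i : CMDiffAt ∞ (fun y ↦ inner ℝ (f i y) (Z y)) x :=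
    hinner (f i) (hf i) fun y ↦ hspan y ▸ subset_span ⟨i, rfl⟩
  have hexpand : CMDiffAt ∞
      (T% (fun y ↦ ∑ i, (inner ℝ (f i y) (Z y) / inner ℝ (f i y) (f i y)) • f i y)) x :=
    ContMDiffAt.sum_section fun i _ ↦
      contMDiffAt_inner_div_smul (hf i) (gramSchmidt_ne_zero i hli) (hfZ i)
  refine hexpand.congr_of_eventuallyEq ?_
  filter_upwards [hZ] with y hy
  rw [sum_inner_div_smul_eq_of_mem_span (gramSchmidt_pairwise_orthogonal ℝ _) ((hspan y).symm ▸ hy)]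

end GramSchmidt

section Distributions

variable {E : Type*} [NormedAddCommGroup E] [NormedSpace ℝ E] [FiniteDimensional ℝ E]
  {M : Type*} [TopologicalSpace M] [ChartedSpace E M] [IsManifold 𝓘(ℝ, E) ∞ M]
  [RiemannianBundle (fun x : M ↦ TangentSpace 𝓘(ℝ, E) x)]
  {D : Π x : M, Submodule ℝ (TangentSpace 𝓘(ℝ, E) x)}

theorem IsSmoothDistribution.isSmoothField_starProjection
    [IsContMDiffRiemannianBundle 𝓘(ℝ, E) ∞ E (fun x : M ↦ TangentSpace 𝓘(ℝ, E) x)]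
    (hD : IsSmoothDistribution D) {X : Π x : M, TangentSpace 𝓘(ℝ, E) x} (hX : IsSmoothField X) :
    IsSmoothField (fun x ↦ (D x).starProjection (X x)) := by
  intro x
  obtain ⟨U, k, e, hU, hxU, he, hUe⟩ := hD x
  have hspan : ∀ᶠ y in nhds x, Submodule.span ℝ (Set.range fun i ↦ e i y) = D y :=
    Filter.eventually_of_mem (hU.mem_nhds hxU) fun y hy ↦ (hUe y hy).2
  refine contMDiffAt_of_inner_frame (fun i ↦ (he i).contMDiffAt (hU.mem_nhds hxU)) (hUe x hxU).1
    ?_ fun W hW hWD ↦ ?_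
  · filter_upwards [hspan] with y hy
    exact hy ▸ Submodule.starProjection_apply_mem _ _
  · have hWX : CMDiffAt ∞ (fun y ↦ inner ℝ (W y) (X y)) x :=
      ContMDiffAt.inner_bundle (E := fun x : M ↦ TangentSpace 𝓘(ℝ, E) x) hW (hX x)
    refine hWX.congr_of_eventuallyEq ?_
    filter_upwards [hspan] with y hy
    rw [← Submodule.inner_starProjection_left_eq_right,
      Submodule.starProjection_eq_self_iff.2 (hy ▸ hWD y)]

theorem exists_isSection_apply_eq [T2Space M]
    (hD : ∀ X, IsSmoothField X → IsSmoothField (fun x ↦ (D x).starProjection (X x)))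
    {x : M} {v : TangentSpace 𝓘(ℝ, E) x} (hv : v ∈ D x) : ∃ X, IsSection D X ∧ X x = v := by
  obtain ⟨X, hX, rfl⟩ := exists_isSmoothField_apply_eq v
  exact ⟨_, ⟨hD X hX, fun y ↦ Submodule.starProjection_apply_mem _ _⟩,
    Submodule.starProjection_eq_self_iff.2 hv⟩

end Distributions

section Splitting

variable {E : Type*} [NormedAddCommGroup E] [NormedSpace ℝ E]
  {M : Type*} [TopologicalSpace M] [ChartedSpace E M]
  [RiemannianBundle (fun x : M ↦ TangentSpace 𝓘(ℝ, E) x)]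
  {F : Type*} [NormedAddCommGroup F] [NormedSpace ℝ F]
  {N : Type*} [TopologicalSpace N] [ChartedSpace F N] {Ψ : M → N}
  {D₁ : Π x : M, Submodule ℝ (TangentSpace 𝓘(ℝ, E) x)} {x : M} {u v : TangentSpace 𝓘(ℝ, E) x}

theorem inner_vertical_horizontal (hu : u ∈ vertical F Ψ x)
    (hv : v ∈ horizontal F Ψ x) : inner ℝ u v = 0 :=
  Submodule.inner_right_of_mem_orthogonal hu hv

theorem inner_horizontal_vertical (hu : u ∈ horizontal F Ψ x)
    (hv : v ∈ vertical F Ψ x) : inner ℝ u v = 0 :=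
  Submodule.inner_left_of_mem_orthogonal hv hu

theorem inner_antiInvariant_D₁ (hu : u ∈ antiInvariant F Ψ D₁ x) (hv : v ∈ D₁ x) :
    inner ℝ u v = 0 :=
  Submodule.inner_left_of_mem_orthogonal hv hu.2

theorem mem_horizontal_of_inner (h : ∀ v ∈ vertical F Ψ x, inner ℝ u v = 0) :
    u ∈ horizontal F Ψ x :=
  (Submodule.mem_orthogonal' _ _).2 h

variable [FiniteDimensional ℝ E]

theorem hproj_mem (x : M) (u : TangentSpace 𝓘(ℝ, E) x) : hproj F Ψ x u ∈ horizontal F Ψ x :=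
  Submodule.starProjection_apply_mem _ _

theorem vproj_mem (x : M) (u : TangentSpace 𝓘(ℝ, E) x) : vproj F Ψ x u ∈ vertical F Ψ x :=
  Submodule.starProjection_apply_mem _ _

theorem vproj_add_hproj (x : M) (u : TangentSpace 𝓘(ℝ, E) x) :
    vproj F Ψ x u + hproj F Ψ x u = u :=
  Submodule.starProjection_add_starProjection_orthogonal u

theorem push_hproj (x : M) (u : TangentSpace 𝓘(ℝ, E) x) :
    push F Ψ x (hproj F Ψ x u) = push F Ψ x u := by
  have hvert : push F Ψ x (vproj F Ψ x u) = 0 := vproj_mem x u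
  conv_rhs => rw [← vproj_add_hproj (F := F) (Ψ := Ψ) x u]
  rw [map_add, hvert, zero_add]

theorem inner_hproj_left (u : TangentSpace 𝓘(ℝ, E) x) (hv : v ∈ horizontal F Ψ x) :
    inner ℝ (hproj F Ψ x u) v = inner ℝ u v := by
  conv_rhs => rw [← vproj_add_hproj (F := F) (Ψ := Ψ) x u]
  rw [inner_add_left, inner_vertical_horizontal (vproj_mem x u) hv, zero_add]

theorem starProjection_antiInvariant (hD₁ : D₁ x ≤ vertical F Ψ x) (u : TangentSpace 𝓘(ℝ, E) x) :
    (antiInvariant F Ψ D₁ x).starProjection u =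
      u - hproj F Ψ x u - (D₁ x).starProjection u := by
  have hmemD₁ := (D₁ x).starProjection_apply_mem u
  refine Submodule.eq_starProjection_of_mem_of_inner_eq_zero ⟨?_, ?_⟩ fun w hw ↦ ?_
  · rw [← eq_sub_of_add_eq (vproj_add_hproj (F := F) (Ψ := Ψ) x u)]
    exact sub_mem (vproj_mem x u) (hD₁ hmemD₁)
  · rw [sub_right_comm]
    exact sub_mem (Submodule.sub_starProjection_mem_orthogonal u)
      (Submodule.orthogonal_le hD₁ (hproj_mem x u))
  · rw [sub_sub, sub_sub_cancel, inner_add_left, inner_horizontal_vertical (hproj_mem x u) hw.1,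
      Submodule.inner_right_of_mem_orthogonal hmemD₁ hw.2, add_zero]

theorem exists_add_eq_of_mem_vertical (hD₁ : D₁ x ≤ vertical F Ψ x) (hu : u ∈ vertical F Ψ x) :
    ∃ a ∈ D₁ x, ∃ b ∈ antiInvariant F Ψ D₁ x, a + b = u :=
  ⟨(D₁ x).starProjection u, Submodule.starProjection_apply_mem _ _, u - (D₁ x).starProjection u,
    ⟨sub_mem hu (hD₁ (Submodule.starProjection_apply_mem _ _)),
      Submodule.sub_starProjection_mem_orthogonal u⟩, add_sub_cancel _ _⟩

theorem mem_vertical_of_inner (h : ∀ v ∈ horizontal F Ψ x, inner ℝ u v = 0) :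
    u ∈ vertical F Ψ x := by
  have hu : u ∈ (vertical F Ψ x)ᗮᗮ := (Submodule.mem_orthogonal' _ _).2 h
  rwa [Submodule.orthogonal_orthogonal] at hu

theorem mem_antiInvariant_of_inner (h : ∀ v ∈ horizontal F Ψ x, inner ℝ u v = 0)
    (h' : ∀ v ∈ D₁ x, inner ℝ u v = 0) : u ∈ antiInvariant F Ψ D₁ x :=
  ⟨mem_vertical_of_inner h, (Submodule.mem_orthogonal' _ _).2 h'⟩

theorem mem_D₁_of_inner (hD₁ : D₁ x ≤ vertical F Ψ x) (hu : u ∈ vertical F Ψ x)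
    (h : ∀ v ∈ antiInvariant F Ψ D₁ x, inner ℝ u v = 0) : u ∈ D₁ x := by
  obtain ⟨a, ha, b, hb, rfl⟩ := exists_add_eq_of_mem_vertical hD₁ hu
  have hb0 := h b hb
  rw [inner_add_left, real_inner_comm, inner_antiInvariant_D₁ hb ha, zero_add] at hb0
  rwa [inner_self_eq_zero.1 hb0, add_zero]

theorem IsConformalSubmersion.inner_push [RiemannianBundle (fun y : N ↦ TangentSpace 𝓘(ℝ, F) y)]
    {dil : M → ℝ} (h : IsConformalSubmersion E F Ψ dil)
    (u : TangentSpace 𝓘(ℝ, E) x) (hv : v ∈ horizontal F Ψ x) :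
    inner ℝ (push F Ψ x u) (push F Ψ x v) = dil x ^ 2 * inner ℝ u v := by
  rw [← push_hproj x u, h.conformal x _ (hproj_mem x u) _ hv, inner_hproj_left u hv]

end Splitting

section SmoothProjections

variable {E : Type*} [NormedAddCommGroup E] [NormedSpace ℝ E]
  {M : Type*} [TopologicalSpace M] [ChartedSpace E M] [IsManifold 𝓘(ℝ, E) ∞ M]
  {F : Type*} [NormedAddCommGroup F] [NormedSpace ℝ F]
  {N : Type*} [TopologicalSpace N] [ChartedSpace F N] [IsManifold 𝓘(ℝ, F) ∞ N]
  [RiemannianBundle (fun y : N ↦ TangentSpace 𝓘(ℝ, F) y)]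
  [IsContMDiffRiemannianBundle 𝓘(ℝ, F) ∞ F (fun y : N ↦ TangentSpace 𝓘(ℝ, F) y)]
  {Ψ : M → N} {dil : M → ℝ} {X Y : Π x : M, TangentSpace 𝓘(ℝ, E) x}

theorem contMDiffAt_inner_push {x : M} (hΨ : CMDiffAt ∞ Ψ x) (hX : CMDiffAt ∞ (T% X) x)
    (hY : CMDiffAt ∞ (T% Y) x) :
    CMDiffAt ∞ (fun y ↦ inner ℝ (push F Ψ y (X y)) (push F Ψ y (Y y))) x :=
  ContMDiffAt.inner_bundle (E := fun y : N ↦ TangentSpace 𝓘(ℝ, F) y)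
    (contMDiffAt_mfderiv_apply (m := ⊤) (n := ⊤) hΨ hX le_top)
    (contMDiffAt_mfderiv_apply (m := ⊤) (n := ⊤) hΨ hY le_top)

variable [FiniteDimensional ℝ E] [RiemannianBundle (fun x : M ↦ TangentSpace 𝓘(ℝ, E) x)]
  [IsContMDiffRiemannianBundle 𝓘(ℝ, E) ∞ E (fun x : M ↦ TangentSpace 𝓘(ℝ, E) x)]

theorem IsConformalSubmersion.isSmoothField_hproj (h : IsConformalSubmersion E F Ψ dil)
    (hdil : CMDiff ∞ (fun x ↦ dil x ^ 2)) (hX : IsSmoothField X) :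
    IsSmoothField (fun x ↦ hproj F Ψ x (X x)) := by
  intro x
  have hdil_ne y : dil y ^ 2 ≠ 0 := pow_ne_zero 2 (h.dil_pos y).ne'
  let t := trivializationAt E (TangentSpace 𝓘(ℝ, E)) x
  have hframe := t.isLocalFrameOn_localFrame_baseSet (n := ∞) 𝓘(ℝ, E) (Module.finBasis ℝ E)
  have hx : x ∈ t.baseSet := mem_baseSet_trivializationAt' x
  refine contMDiffAt_of_inner_frame (fun i ↦ hframe.contMDiffAt t.open_baseSet hx i)
    (hframe.linearIndependent hx) ?_ fun W hW _ ↦ ?_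
  · filter_upwards [t.open_baseSet.mem_nhds hx] with y hy using hframe.generating hy trivial
  · have hquot : CMDiffAt ∞
        (fun y ↦ inner ℝ (push F Ψ y (W y)) (push F Ψ y (X y)) / dil y ^ 2) x :=
      (contMDiffAt_inner_push (h.smooth x) hW (hX x)).div₀ (hdil x) (hdil_ne x)
    refine hquot.congr_of_eventuallyEq (.of_forall fun y ↦ ?_)
    beta_reduce
    rw [← push_hproj y (X y), h.inner_push _ (hproj_mem y _), mul_div_cancel_left₀ _ (hdil_ne y)]

theorem IsConformalSubmersion.isSmoothField_vproj (h : IsConformalSubmersion E F Ψ dil)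
    (hdil : CMDiff ∞ (fun x ↦ dil x ^ 2)) (hX : IsSmoothField X) :
    IsSmoothField (fun x ↦ vproj F Ψ x (X x)) := by
  simp only [eq_sub_of_add_eq (vproj_add_hproj (F := F) (Ψ := Ψ) _ _)]
  exact hX.sub (h.isSmoothField_hproj hdil hX)

theorem IsConformalSubmersion.isSmoothField_starProjection_antiInvariant
    {D₁ : Π x : M, Submodule ℝ (TangentSpace 𝓘(ℝ, E) x)}
    (h : IsConformalSubmersion E F Ψ dil) (hdil : CMDiff ∞ (fun x ↦ dil x ^ 2))
    (hD₁ : IsSmoothDistribution D₁) (hle : ∀ x, D₁ x ≤ vertical F Ψ x) (hX : IsSmoothField X) :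
    IsSmoothField (fun x ↦ (antiInvariant F Ψ D₁ x).starProjection (X x)) := by
  simp only [starProjection_antiInvariant (hle _)]
  exact (hX.sub (h.isSmoothField_hproj hdil hX)).sub (hD₁.isSmoothField_starProjection hX)

end SmoothProjections

section LeviCivitaFields

variable {E : Type*} [NormedAddCommGroup E] [NormedSpace ℝ E] [FiniteDimensional ℝ E]
  {M : Type*} [TopologicalSpace M] [ChartedSpace E M] [IsManifold 𝓘(ℝ, E) ∞ M]
  [RiemannianBundle (fun x : M ↦ TangentSpace 𝓘(ℝ, E) x)]
  [IsContMDiffRiemannianBundle 𝓘(ℝ, E) ∞ E (fun x : M ↦ TangentSpace 𝓘(ℝ, E) x)]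
  {P Q R : Π x : M, TangentSpace 𝓘(ℝ, E) x}

theorem mvfderiv_inner (hQ : IsSmoothField Q) (hR : IsSmoothField R)
    (P : Π x : M, TangentSpace 𝓘(ℝ, E) x) (x : M) :
    d% (fun y ↦ inner ℝ (Q y) (R y)) x (P x) =
      inner ℝ (nabla P Q x) (R x) + inner ℝ (Q x) (nabla P R x) :=
  leviCivita_metric (hQ.mdifferentiableAt x) (hR.mdifferentiableAt x) (P x)

theorem inner_nabla_of_orthogonal (hQ : IsSmoothField Q) (hR : IsSmoothField R)
    (h : ∀ x, inner ℝ (Q x) (R x) = 0) (P : Π x : M, TangentSpace 𝓘(ℝ, E) x) (x : M) :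
    inner ℝ (nabla P Q x) (R x) = -inner ℝ (Q x) (nabla P R x) := by
  have hderiv := mvfderiv_inner hQ hR P x
  rw [funext h, mvfderiv_const] at hderiv
  exact eq_neg_of_add_eq_zero_left hderiv.symm

theorem mlieBracket_eq_nabla (hP : IsSmoothField P) (hQ : IsSmoothField Q) (x : M) :
    mlieBracket 𝓘(ℝ, E) P Q x = nabla P Q x - nabla Q P x :=
  (leviCivita_torsionFree (hP.mdifferentiableAt x) (hQ.mdifferentiableAt x)).symm

theorem inner_nabla_eq_koszul (hP : IsSmoothField P) (hQ : IsSmoothField Q)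
    (hR : IsSmoothField R) (x : M) : inner ℝ (nabla P Q x) (R x) = koszul Q P R x :=
  inner_leviCivitaFun (hP.mdifferentiableAt x) (hQ.mdifferentiableAt x) (hR.mdifferentiableAt x)

theorem mdifferentiableAt_inner_nabla (hP : IsSmoothField P) (hQ : IsSmoothField Q)
    (hR : IsSmoothField R) (x : M) : MDiffAt (fun y ↦ inner ℝ (nabla P Q y) (R y)) x := by
  have := FiniteDimensional.complete ℝ E
  have hderiv {X Y Z : Π x : M, TangentSpace 𝓘(ℝ, E) x} (hX : IsSmoothField X)
      (hY : IsSmoothField Y) (hZ : IsSmoothField Z) :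
      MDiffAt (fun y ↦ d% (fun z ↦ inner ℝ (X z) (Y z)) y (Z y)) x :=
    mdifferentiableAt_mvfderiv_apply ((hX.inner hY).of_le (WithTop.coe_le_coe.2 le_top) x)
      ((hZ.contMDiffAt_two x).of_le one_le_two)
  have hbracket {X Y Z : Π x : M, TangentSpace 𝓘(ℝ, E) x} (hX : IsSmoothField X)
      (hY : IsSmoothField Y) (hZ : IsSmoothField Z) :
      MDiffAt (fun y ↦ inner ℝ (mlieBracket 𝓘(ℝ, E) X Y y) (Z y)) x :=
    mdifferentiableAt_inner ((hX.mlieBracket hY).mdifferentiableAt x) (hZ.mdifferentiableAt x)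
  rw [funext (inner_nabla_eq_koszul hP hQ hR)]
  unfold koszul
  simp only [div_eq_inv_mul]
  exact (((((hderiv hQ hR hP).add (hderiv hP hR hQ)).sub (hderiv hP hQ hR)).add
    (hbracket hP hQ hR)).sub (hbracket hP hR hQ)).sub (hbracket hQ hR hP) |>.const_smul (2⁻¹ : ℝ)

theorem nabla_add_smul_left (a : ℝ) (X X' Y : Π x : M, TangentSpace 𝓘(ℝ, E) x) (x : M) :
    nabla (fun y ↦ X y + a • X' y) Y x = nabla X Y x + a • nabla X' Y x := by
  simp only [nabla, map_add, map_smul]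

theorem nabla_add_smul_right (a : ℝ) (X : Π x : M, TangentSpace 𝓘(ℝ, E) x)
    (hP : IsSmoothField P) (hQ : IsSmoothField Q) (x : M) :
    nabla X (fun y ↦ P y + a • Q y) x = nabla X P x + a • nabla X Q x := by
  have hQx := hQ.mdifferentiableAt x
  have hadd := (leviCivita E M).isCovariantDerivativeOnUniv.add (hP.mdifferentiableAt x)
    ((hQ.const_smul a).mdifferentiableAt x)
  have hsmul := (leviCivita E M).isCovariantDerivativeOnUniv.smul_const a hQx
  have h := DFunLike.congr_fun (hadd.trans (congrArg _ hsmul)) (X x)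
  exact h

end LeviCivitaFields

section Killing

variable {E : Type*} [NormedAddCommGroup E] [NormedSpace ℝ E]
  {M : Type*} [TopologicalSpace M] [ChartedSpace E M] [IsManifold 𝓘(ℝ, E) ∞ M]
  [RiemannianBundle (fun x : M ↦ TangentSpace 𝓘(ℝ, E) x)]
  {K P Q R : Π x : M, TangentSpace 𝓘(ℝ, E) x}

/-- Killing fields: smooth vector fields `K` along which the Lie derivative of the metric
vanishes. -/
structure IsKillingField (K : Π x : M, TangentSpace 𝓘(ℝ, E) x) : Prop where
  smooth : IsSmoothField K
  mvfderiv_metric : ∀ P Q : Π x : M, TangentSpace 𝓘(ℝ, E) x, IsSmoothField P → IsSmoothField Q →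
    ∀ x, d% (fun y ↦ inner ℝ (P y) (Q y)) x (K x) =
      inner ℝ (mlieBracket 𝓘(ℝ, E) K P x) (Q x) + inner ℝ (P x) (mlieBracket 𝓘(ℝ, E) K Q x)

theorem IsKillingField.inner_mlieBracket_of_orthogonal (hK : IsKillingField K)
    (hP : IsSmoothField P) (hQ : IsSmoothField Q) (h : ∀ x, inner ℝ (P x) (Q x) = 0) (x : M) :
    inner ℝ (mlieBracket 𝓘(ℝ, E) K P x) (Q x) =
      -inner ℝ (P x) (mlieBracket 𝓘(ℝ, E) K Q x) := by
  have hderiv := hK.mvfderiv_metric P Q hP hQ x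
  rw [funext h, mvfderiv_const] at hderiv
  exact eq_neg_of_add_eq_zero_left hderiv.symm

variable [FiniteDimensional ℝ E]
  [IsContMDiffRiemannianBundle 𝓘(ℝ, E) ∞ E (fun x : M ↦ TangentSpace 𝓘(ℝ, E) x)]

/-- `⟨(L_K ∇)(P, Q), R⟩` for a Killing field `K`, where
`(L_K ∇)(P, Q) = [K, ∇_P Q] - ∇_{[K, P]} Q - ∇_P [K, Q]`. The Killing equation is used to replace
`⟨[K, ∇_P Q], R⟩` by `K⟨∇_P Q, R⟩ - ⟨∇_P Q, [K, R]⟩`. -/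
noncomputable def innerLieDerivNabla (K P Q R : Π x : M, TangentSpace 𝓘(ℝ, E) x) (x : M) : ℝ :=
  d% (fun y ↦ inner ℝ (nabla P Q y) (R y)) x (K x) -
    inner ℝ (nabla (fun y ↦ mlieBracket 𝓘(ℝ, E) K P y) Q x) (R x) -
    inner ℝ (nabla P (fun y ↦ mlieBracket 𝓘(ℝ, E) K Q y) x) (R x) -
    inner ℝ (nabla P Q x) (mlieBracket 𝓘(ℝ, E) K R x)

theorem IsKillingField.innerLieDerivNabla_swap_left (hK : IsKillingField K)
    (hP : IsSmoothField P) (hQ : IsSmoothField Q) (hR : IsSmoothField R) (x : M) :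
    innerLieDerivNabla K P Q R x = innerLieDerivNabla K Q P R x := by
  have := FiniteDimensional.complete ℝ E
  have hKP := hK.smooth.mlieBracket hP
  have hKQ := hK.smooth.mlieBracket hQ
  have hderiv := hK.mvfderiv_metric _ R (hP.mlieBracket hQ) hR x
  have hsub : (fun y ↦ inner ℝ (mlieBracket 𝓘(ℝ, E) P Q y) (R y)) =
      fun y ↦ inner ℝ (nabla P Q y) (R y) - inner ℝ (nabla Q P y) (R y) := by
    funext y
    rw [mlieBracket_eq_nabla hP hQ, inner_sub_left]
  rw [hsub, mvfderiv_fun_sub (mdifferentiableAt_inner_nabla hP hQ hR x)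
    (mdifferentiableAt_inner_nabla hQ hP hR x), sub_apply, mlieBracket_jacobi
    (hK.smooth.contMDiffAt_two x) (hP.contMDiffAt_two x) (hQ.contMDiffAt_two x),
    mlieBracket_eq_nabla hKP hQ, mlieBracket_eq_nabla hP hKQ, mlieBracket_eq_nabla hP hQ] at hderiv
  simp only [inner_add_left, inner_sub_left] at hderiv
  unfold innerLieDerivNabla
  linear_combination hderiv

theorem IsKillingField.innerLieDerivNabla_swap_right (hK : IsKillingField K)
    (hP : IsSmoothField P) (hQ : IsSmoothField Q) (hR : IsSmoothField R) (x : M) :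
    innerLieDerivNabla K P Q R x = -innerLieDerivNabla K P R Q x := by
  have := FiniteDimensional.complete ℝ E
  have hKQ := hK.smooth.mlieBracket hQ
  have hKR := hK.smooth.mlieBracket hR
  have hmetricP : (fun y ↦ d% (fun z ↦ inner ℝ (Q z) (R z)) y (P y)) =
      fun y ↦ inner ℝ (nabla P Q y) (R y) + inner ℝ (nabla P R y) (Q y) := by
    funext y
    rw [mvfderiv_inner hQ hR P, real_inner_comm (Q y)]
  have hKP : d% (fun y ↦ d% (fun z ↦ inner ℝ (Q z) (R z)) y (P y)) x (K x) =
      d% (fun y ↦ inner ℝ (nabla P Q y) (R y)) x (K x) +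
        d% (fun y ↦ inner ℝ (nabla P R y) (Q y)) x (K x) := by
    rw [hmetricP, mvfderiv_fun_add (mdifferentiableAt_inner_nabla hP hQ hR x)
      (mdifferentiableAt_inner_nabla hP hR hQ x), add_apply]
  have hPK : d% (fun y ↦ d% (fun z ↦ inner ℝ (Q z) (R z)) y (K y)) x (P x) =
      d% (fun y ↦ inner ℝ (mlieBracket 𝓘(ℝ, E) K Q y) (R y)) x (P x) +
        d% (fun y ↦ inner ℝ (Q y) (mlieBracket 𝓘(ℝ, E) K R y)) x (P x) := by
    rw [funext (hK.mvfderiv_metric Q R hQ hR), mvfderiv_fun_add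
      (mdifferentiableAt_inner (hKQ.mdifferentiableAt x) (hR.mdifferentiableAt x))
      (mdifferentiableAt_inner (hQ.mdifferentiableAt x) (hKR.mdifferentiableAt x)), add_apply]
  have hbracket := mvfderiv_mlieBracket ((hQ.inner hR).of_le (WithTop.coe_le_coe.2 le_top) x)
    (hK.smooth.contMDiffAt_two x) (hP.contMDiffAt_two x)
  rw [hKP, hPK, mvfderiv_inner hKQ hR P, mvfderiv_inner hQ hKR P,
    mvfderiv_inner hQ hR (fun y ↦ mlieBracket 𝓘(ℝ, E) K P y)] at hbracket
  rw [real_inner_comm _ (Q x), real_inner_comm _ (Q x),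
    real_inner_comm _ (mlieBracket 𝓘(ℝ, E) K Q x)] at hbracket
  unfold innerLieDerivNabla
  linear_combination -hbracket

theorem IsKillingField.innerLieDerivNabla_eq_zero (hK : IsKillingField K)
    (hP : IsSmoothField P) (hQ : IsSmoothField Q) (hR : IsSmoothField R) (x : M) :
    innerLieDerivNabla K P Q R x = 0 := by
  -- A trilinear form symmetric in two slots and skew in two slots vanishes.
  have hskew : innerLieDerivNabla K P Q R x = -innerLieDerivNabla K P Q R x := calc
    _ = -innerLieDerivNabla K P R Q x := hK.innerLieDerivNabla_swap_right hP hQ hR x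
    _ = -innerLieDerivNabla K R P Q x := by rw [hK.innerLieDerivNabla_swap_left hP hR hQ x]
    _ = innerLieDerivNabla K R Q P x := by
      rw [hK.innerLieDerivNabla_swap_right hR hP hQ x, neg_neg]
    _ = innerLieDerivNabla K Q R P x := hK.innerLieDerivNabla_swap_left hR hQ hP x
    _ = -innerLieDerivNabla K Q P R x := hK.innerLieDerivNabla_swap_right hQ hR hP x
    _ = -innerLieDerivNabla K P Q R x := by rw [hK.innerLieDerivNabla_swap_left hQ hP hR x]
  exact self_eq_neg.1 hskew

theorem IsKillingField.mvfderiv_inner_nabla (hK : IsKillingField K)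
    (hP : IsSmoothField P) (hQ : IsSmoothField Q) (hR : IsSmoothField R) (x : M) :
    d% (fun y ↦ inner ℝ (nabla P Q y) (R y)) x (K x) =
      inner ℝ (nabla (fun y ↦ mlieBracket 𝓘(ℝ, E) K P y) Q x) (R x) +
      inner ℝ (nabla P (fun y ↦ mlieBracket 𝓘(ℝ, E) K Q y) x) (R x) +
      inner ℝ (nabla P Q x) (mlieBracket 𝓘(ℝ, E) K R x) := by
  have hzero := hK.innerLieDerivNabla_eq_zero hP hQ hR x
  unfold innerLieDerivNabla at hzero
  linear_combination hzero

end Killing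

section Sasakian

variable {E : Type*} [NormedAddCommGroup E] [NormedSpace ℝ E]
  {M : Type*} [TopologicalSpace M] [ChartedSpace E M] [IsManifold 𝓘(ℝ, E) ∞ M]
  [RiemannianBundle (fun x : M ↦ TangentSpace 𝓘(ℝ, E) x)]
  {φ : Π x : M, TangentSpace 𝓘(ℝ, E) x →L[ℝ] TangentSpace 𝓘(ℝ, E) x}
  {ζ : Π x : M, TangentSpace 𝓘(ℝ, E) x} {η : Π x : M, TangentSpace 𝓘(ℝ, E) x →L[ℝ] ℝ}
  {P Q : Π x : M, TangentSpace 𝓘(ℝ, E) x} {x : M} {u v : TangentSpace 𝓘(ℝ, E) x}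

theorem IsAlmostContactMetric.phi_phi_of_eta (hM : IsAlmostContactMetric φ ζ η)
    (hu : η x u = 0) : φ x (φ x u) = -u := by
  rw [hM.phi_phi, hu, zero_smul, add_zero]

theorem IsAlmostContactMetric.inner_phi_phi_of_eta (hM : IsAlmostContactMetric φ ζ η)
    (hv : η x v = 0) : inner ℝ (φ x u) (φ x v) = inner ℝ u v := by
  rw [hM.inner_phi_phi, hv, mul_zero, sub_zero]

theorem IsAlmostContactMetric.isSmoothField_phi (hM : IsAlmostContactMetric φ ζ η)
    (hP : IsSmoothField P) : IsSmoothField (fun x ↦ φ x (P x)) :=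
  hP.clm_apply hM.smooth_phi

variable [FiniteDimensional ℝ E]
  [IsContMDiffRiemannianBundle 𝓘(ℝ, E) ∞ E (fun x : M ↦ TangentSpace 𝓘(ℝ, E) x)]

theorem IsSasakian.inner_nabla_phi (hM : IsSasakian φ ζ η) (hP : IsSmoothField P)
    (hQ : IsSmoothField Q) (hηQ : η x (Q x) = 0) (hv : η x v = 0) :
    inner ℝ (nabla P (fun y ↦ φ y (Q y)) x) v = -inner ℝ (nabla P Q x) (φ x v) := by
  have hphi := hM.nabla_phi P Q hP hQ x
  rw [sub_eq_iff_eq_add, hηQ, zero_smul, sub_zero] at hphi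
  rw [hphi, inner_add_left, real_inner_smul_left, real_inner_comm v (ζ x), hM.inner_reeb, hv,
    mul_zero, zero_add, hM.inner_phi]

theorem IsSasakian.inner_nabla_phi_phi (hM : IsSasakian φ ζ η) (hP : IsSmoothField P)
    (hQ : IsSmoothField Q) (hηQ : η x (Q x) = 0) (hv : η x v = 0) :
    inner ℝ (nabla P (fun y ↦ φ y (Q y)) x) (φ x v) = inner ℝ (nabla P Q x) v := by
  rw [hM.inner_nabla_phi hP hQ hηQ (hM.eta_phi x v), hM.phi_phi_of_eta hv, inner_neg_right,
    neg_neg]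

theorem IsSasakian.reeb_mlieBracket (hM : IsSasakian φ ζ η) (hP : IsSmoothField P) (x : M) :
    mlieBracket 𝓘(ℝ, E) ζ P x = nabla ζ P x + φ x (P x) := by
  rw [mlieBracket_eq_nabla hM.smooth_reeb hP, hM.nabla_reeb P hP, sub_neg_eq_add]

theorem IsSasakian.isKillingField_reeb (hM : IsSasakian φ ζ η) : IsKillingField ζ where
  smooth := hM.smooth_reeb
  mvfderiv_metric P Q hP hQ x := by
    rw [mvfderiv_inner hP hQ, hM.reeb_mlieBracket hP, hM.reeb_mlieBracket hQ, inner_add_left,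
      inner_add_right, hM.inner_phi]
    ring

theorem IsSasakian.reeb_mlieBracket_phi (hM : IsSasakian φ ζ η) (hP : IsSmoothField P) (x : M) :
    mlieBracket 𝓘(ℝ, E) ζ (fun y ↦ φ y (P y)) x = φ x (mlieBracket 𝓘(ℝ, E) ζ P x) := by
  have hphi := hM.nabla_phi ζ P hM.smooth_reeb hP x
  rw [real_inner_comm (P x) (ζ x), hM.inner_reeb, sub_self, sub_eq_zero] at hphi
  rw [hM.reeb_mlieBracket (hM.isSmoothField_phi hP), hM.reeb_mlieBracket hP, map_add, hphi]

end Sasakian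

section SemiInvariant

variable {E : Type*} [NormedAddCommGroup E] [NormedSpace ℝ E]
  {M : Type*} [TopologicalSpace M] [ChartedSpace E M]
  [RiemannianBundle (fun x : M ↦ TangentSpace 𝓘(ℝ, E) x)]
  {F : Type*} [NormedAddCommGroup F] [NormedSpace ℝ F]
  {N : Type*} [TopologicalSpace N] [ChartedSpace F N]
  {φ : Π x : M, TangentSpace 𝓘(ℝ, E) x →L[ℝ] TangentSpace 𝓘(ℝ, E) x}
  {ζ : Π x : M, TangentSpace 𝓘(ℝ, E) x} {η : Π x : M, TangentSpace 𝓘(ℝ, E) x →L[ℝ] ℝ}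
  {Ψ : M → N} {dil : M → ℝ} {D₁ : Π x : M, Submodule ℝ (TangentSpace 𝓘(ℝ, E) x)}
  {Z : Π x : M, TangentSpace 𝓘(ℝ, E) x} {x : M}
  {u v : TangentSpace 𝓘(ℝ, E) x}

variable (F) in
/-- The orthogonal complement of the Reeb field in `μ`. It is invariant under `φ`, whereas `μ`
itself is not: `φ ζ = 0`. -/
noncomputable def muReebPerp (φ : Π x : M, TangentSpace 𝓘(ℝ, E) x →L[ℝ] TangentSpace 𝓘(ℝ, E) x)
    (η : Π x : M, TangentSpace 𝓘(ℝ, E) x →L[ℝ] ℝ) (Ψ : M → N)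
    (D₁ : Π x : M, Submodule ℝ (TangentSpace 𝓘(ℝ, E) x)) (x : M) :
    Submodule ℝ (TangentSpace 𝓘(ℝ, E) x) :=
  muDist F φ Ψ D₁ x ⊓ LinearMap.ker (η x).toLinearMap

theorem mem_muDist_of_inner (hu : u ∈ horizontal F Ψ x)
    (h : ∀ v ∈ antiInvariant F Ψ D₁ x, inner ℝ u (φ x v) = 0) : u ∈ muDist F φ Ψ D₁ x := by
  refine ⟨hu, (Submodule.mem_orthogonal' _ _).2 ?_⟩
  rintro _ ⟨v, hv, rfl⟩
  exact h v hv

theorem inner_muDist_phi (hu : u ∈ muDist F φ Ψ D₁ x) (hv : v ∈ antiInvariant F Ψ D₁ x) :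
    inner ℝ u (φ x v) = 0 :=
  Submodule.inner_left_of_mem_orthogonal (K := (antiInvariant F Ψ D₁ x).map (φ x).toLinearMap)
    ⟨v, hv, rfl⟩ hu.2

theorem alphaPart_mem [FiniteDimensional ℝ E] (Z : Π x : M, TangentSpace 𝓘(ℝ, E) x) (x : M) :
    alphaPart F φ Ψ D₁ Z x ∈ antiInvariant F Ψ D₁ x :=
  Submodule.starProjection_apply_mem _ _

variable [IsManifold 𝓘(ℝ, E) ∞ M] [RiemannianBundle (fun y : N ↦ TangentSpace 𝓘(ℝ, F) y)]

theorem IsSicReebPerpSubmersion.phi_mem_D₁ (hΨ : IsSicReebPerpSubmersion F φ ζ Ψ dil D₁)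
    (hu : u ∈ D₁ x) : φ x u ∈ D₁ x := by
  rw [← hΨ.map_D₁ x]
  exact ⟨u, hu, rfl⟩

theorem IsSicReebPerpSubmersion.phi_mem_horizontal (hΨ : IsSicReebPerpSubmersion F φ ζ Ψ dil D₁)
    (hu : u ∈ antiInvariant F Ψ D₁ x) : φ x u ∈ horizontal F Ψ x :=
  hΨ.map_D₂ x ⟨u, hu, rfl⟩

theorem IsAlmostContactMetric.eta_vertical (hM : IsAlmostContactMetric φ ζ η)
    (hΨ : IsSicReebPerpSubmersion F φ ζ Ψ dil D₁) (hu : u ∈ vertical F Ψ x) : η x u = 0 := by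
  rw [← hM.inner_reeb, inner_vertical_horizontal hu (hΨ.reeb_horizontal x)]

variable [FiniteDimensional ℝ E]

theorem IsAlmostContactMetric.phi_mem_muReebPerp (hM : IsAlmostContactMetric φ ζ η)
    (hΨ : IsSicReebPerpSubmersion F φ ζ Ψ dil D₁) (hu : u ∈ muReebPerp F φ η Ψ D₁ x) :
    φ x u ∈ muReebPerp F φ η Ψ D₁ x := by
  refine ⟨mem_muDist_of_inner (mem_horizontal_of_inner fun v hv ↦ ?_) fun v hv ↦ ?_, hM.eta_phi x u⟩
  · obtain ⟨a, ha, b, hb, rfl⟩ := exists_add_eq_of_mem_vertical (hΨ.D₁_le x) hv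
    rw [hM.inner_phi, map_add, inner_add_right,
      inner_horizontal_vertical hu.1.1 (hΨ.D₁_le x (hΨ.phi_mem_D₁ ha)), inner_muDist_phi hu.1 hb,
      add_zero, neg_zero]
  · rw [hM.inner_phi_phi_of_eta (hM.eta_vertical hΨ hv.1), inner_horizontal_vertical hu.1.1 hv.1]

theorem IsAlmostContactMetric.alphaPart_add_betaPart (hM : IsAlmostContactMetric φ ζ η)
    (hΨ : IsSicReebPerpSubmersion F φ ζ Ψ dil D₁) (hZ : Z x ∈ horizontal F Ψ x) :
    alphaPart F φ Ψ D₁ Z x + betaPart F φ Ψ D₁ Z x = φ x (Z x) := by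
  have ha := alphaPart_mem (F := F) (φ := φ) (Ψ := Ψ) (D₁ := D₁) Z x
  have hb : φ x (Z x) - alphaPart F φ Ψ D₁ Z x ∈ (antiInvariant F Ψ D₁ x)ᗮ :=
    Submodule.sub_starProjection_mem_orthogonal _
  rw [← eq_sub_iff_add_eq']
  refine Submodule.eq_starProjection_of_mem_of_inner_eq_zero
    (mem_muDist_of_inner (mem_horizontal_of_inner fun v hv ↦ ?_) fun v hv ↦ ?_) fun v hv ↦ ?_
  · obtain ⟨c, hc, d, hd, rfl⟩ := exists_add_eq_of_mem_vertical (hΨ.D₁_le x) hv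
    rw [inner_add_right, Submodule.inner_left_of_mem_orthogonal hd hb, inner_sub_left,
      hM.inner_phi, inner_horizontal_vertical hZ (hΨ.D₁_le x (hΨ.phi_mem_D₁ hc)),
      inner_antiInvariant_D₁ ha hc, neg_zero, sub_zero, add_zero]
  · rw [inner_sub_left, hM.inner_phi_phi_of_eta (hM.eta_vertical hΨ hv.1),
      inner_horizontal_vertical hZ hv.1,
      inner_vertical_horizontal ha.1 (hΨ.phi_mem_horizontal hv), sub_zero]
  · rw [sub_sub_cancel, inner_vertical_horizontal ha.1 hv.1]

theorem IsAlmostContactMetric.betaPart_mem (hM : IsAlmostContactMetric φ ζ η)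
    (hΨ : IsSicReebPerpSubmersion F φ ζ Ψ dil D₁) (hZ : Z x ∈ horizontal F Ψ x) :
    betaPart F φ Ψ D₁ Z x ∈ muReebPerp F φ η Ψ D₁ x := by
  refine ⟨Submodule.starProjection_apply_mem _ _, ?_⟩
  change η x _ = 0
  rw [eq_sub_of_add_eq' (hM.alphaPart_add_betaPart hΨ hZ), map_sub, hM.eta_phi,
    hM.eta_vertical hΨ (alphaPart_mem Z x).1, sub_zero]

end SemiInvariant

section Conformal

variable {E : Type*} [NormedAddCommGroup E] [NormedSpace ℝ E]
  {M : Type*} [TopologicalSpace M] [ChartedSpace E M]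
  {F : Type*} [NormedAddCommGroup F] [NormedSpace ℝ F] [FiniteDimensional ℝ F]
  {N : Type*} [TopologicalSpace N] [ChartedSpace F N] [IsManifold 𝓘(ℝ, F) ∞ N]
  [RiemannianBundle (fun y : N ↦ TangentSpace 𝓘(ℝ, F) y)]
  [IsContMDiffRiemannianBundle 𝓘(ℝ, F) ∞ F (fun y : N ↦ TangentSpace 𝓘(ℝ, F) y)]
  {Ψ : M → N} {dil : M → ℝ} {X Y Z W : Π x : M, TangentSpace 𝓘(ℝ, E) x} {x : M}

theorem pullbackNabla_push_vertical (hΨ : MDiffAt Ψ x) (hW : ∀ x, W x ∈ vertical F Ψ x)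
    (X : Π x : M, TangentSpace 𝓘(ℝ, E) x) :
    pullbackNabla F Ψ X (fun y ↦ push F Ψ y (W y)) x = 0 := by
  have hzero : (fun y ↦ push F Ψ y (W y)) = fun _ ↦ 0 := funext hW
  rw [hzero, pullbackNabla_zero hΨ]

variable [FiniteDimensional ℝ E] [IsManifold 𝓘(ℝ, E) ∞ M]
  [RiemannianBundle (fun x : M ↦ TangentSpace 𝓘(ℝ, E) x)]
  [IsContMDiffRiemannianBundle 𝓘(ℝ, E) ∞ E (fun x : M ↦ TangentSpace 𝓘(ℝ, E) x)]

theorem IsConformalSubmersion.inner_pullbackNabla_add (hΨ : IsConformalSubmersion E F Ψ dil)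
    (hdil : MDiffAt (fun y : M ↦ dil y ^ 2) x) (X : Π x : M, TangentSpace 𝓘(ℝ, E) x)
    (hY : IsSection (horizontal F Ψ) Y) (hZ : IsSection (horizontal F Ψ) Z) :
    inner ℝ (pullbackNabla F Ψ X (fun y ↦ push F Ψ y (Y y)) x) (push F Ψ x (Z x)) +
        inner ℝ (pullbackNabla F Ψ X (fun y ↦ push F Ψ y (Z y)) x) (push F Ψ x (Y x)) =
      d% (fun y ↦ dil y ^ 2) x (X x) * inner ℝ (Y x) (Z x) +
        dil x ^ 2 * (inner ℝ (nabla X Y x) (Z x) + inner ℝ (nabla X Z x) (Y x)) := by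
  have hpush {Y : Π x : M, TangentSpace 𝓘(ℝ, E) x} (hY : IsSmoothField Y) :
      MDiffAt (fun y ↦ (⟨Ψ y, push F Ψ y (Y y)⟩ : TangentBundle 𝓘(ℝ, F) N)) x :=
    (contMDiffAt_mfderiv_apply (m := ⊤) (n := ⊤) (hΨ.smooth x) (hY x) le_top).mdifferentiableAt
      (by simp)
  have hmetric := pullbackNabla_metric (hpush hY.1) (hpush hZ.1) X
  have hconf : (fun y ↦ inner ℝ (push F Ψ y (Y y)) (push F Ψ y (Z y))) =
      fun y ↦ dil y ^ 2 * inner ℝ (Y y) (Z y) := funext fun y ↦ hΨ.inner_push _ (hZ.2 y)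
  rw [hconf, mvfderiv_fun_mul hdil
    (mdifferentiableAt_inner (hY.1.mdifferentiableAt x) (hZ.1.mdifferentiableAt x))] at hmetric
  simp only [add_apply, smul_apply, smul_eq_mul] at hmetric
  rw [mvfderiv_inner hY.1 hZ.1] at hmetric
  rw [real_inner_comm (push F Ψ x (Y x)), ← hmetric, real_inner_comm (nabla X Z x)]
  ring

theorem IsConformalSubmersion.inner_pullbackNabla_sub (hΨ : IsConformalSubmersion E F Ψ dil)
    (hX : IsSmoothField X) (hY : IsSmoothField Y) (hZ : Z x ∈ horizontal F Ψ x) :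
    inner ℝ (pullbackNabla F Ψ X (fun y ↦ push F Ψ y (Y y)) x) (push F Ψ x (Z x)) -
        inner ℝ (pullbackNabla F Ψ Y (fun y ↦ push F Ψ y (X y)) x) (push F Ψ x (Z x)) =
      dil x ^ 2 * (inner ℝ (nabla X Y x) (Z x) - inner ℝ (nabla Y X x) (Z x)) := by
  have := FiniteDimensional.complete ℝ E
  have htorsion := pullbackNabla_torsionFree
    ((hΨ.smooth x).of_le (WithTop.coe_le_coe.2 le_top)) (hX.contMDiffAt_two x)
    (hY.contMDiffAt_two x)
  rw [← inner_sub_left, htorsion, hΨ.inner_push _ hZ, mlieBracket_eq_nabla hX hY, inner_sub_left]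

theorem IsConformalSubmersion.inner_pullbackNabla (hΨ : IsConformalSubmersion E F Ψ dil)
    (hdil : MDiffAt (fun y : M ↦ dil y ^ 2) x) (hX : IsSection (horizontal F Ψ) X)
    (hY : IsSection (horizontal F Ψ) Y) (hZ : IsSection (horizontal F Ψ) Z) :
    inner ℝ (pullbackNabla F Ψ X (fun y ↦ push F Ψ y (Y y)) x) (push F Ψ x (Z x)) =
      dil x ^ 2 * inner ℝ (nabla X Y x) (Z x) +
        (d% (fun y ↦ dil y ^ 2) x (X x) * inner ℝ (Y x) (Z x) +
          d% (fun y ↦ dil y ^ 2) x (Y x) * inner ℝ (X x) (Z x) -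
          d% (fun y ↦ dil y ^ 2) x (Z x) * inner ℝ (X x) (Y x)) / 2 := by
  -- Koszul's argument: combine the metric and torsion identities cyclically.
  have hmetricX := hΨ.inner_pullbackNabla_add hdil X hY hZ
  have hmetricY := hΨ.inner_pullbackNabla_add hdil Y hX hZ
  have hmetricZ := hΨ.inner_pullbackNabla_add hdil Z hX hY
  have htorsionXY := hΨ.inner_pullbackNabla_sub hX.1 hY.1 (hZ.2 x)
  have htorsionXZ := hΨ.inner_pullbackNabla_sub hX.1 hZ.1 (hY.2 x)
  have htorsionYZ := hΨ.inner_pullbackNabla_sub hY.1 hZ.1 (hX.2 x)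
  linarith

theorem IsConformalSubmersion.inner_nabla_vertical_add (hΨ : IsConformalSubmersion E F Ψ dil)
    (hdil : MDiffAt (fun y : M ↦ dil y ^ 2) x) (hW : IsSection (vertical F Ψ) W)
    (hX : IsSection (horizontal F Ψ) X) (hY : IsSection (horizontal F Ψ) Y) :
    dil x ^ 2 * (inner ℝ (nabla X W x) (Y x) + inner ℝ (nabla Y W x) (X x)) =
      -(d% (fun y ↦ dil y ^ 2) x (W x) * inner ℝ (X x) (Y x)) := by
  have hmetric := hΨ.inner_pullbackNabla_add hdil W hX hY
  have htorsionX := hΨ.inner_pullbackNabla_sub hW.1 hX.1 (hY.2 x)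
  have htorsionY := hΨ.inner_pullbackNabla_sub hW.1 hY.1 (hX.2 x)
  have hmdiff := (hΨ.smooth x).mdifferentiableAt (by simp)
  rw [pullbackNabla_push_vertical hmdiff hW.2, inner_zero_left, sub_zero] at htorsionX htorsionY
  linarith

end Conformal

section Sections

variable {E : Type*} [NormedAddCommGroup E] [NormedSpace ℝ E]
  {M : Type*} [TopologicalSpace M] [ChartedSpace E M] [IsManifold 𝓘(ℝ, E) ∞ M]
  [RiemannianBundle (fun x : M ↦ TangentSpace 𝓘(ℝ, E) x)]
  {F : Type*} [NormedAddCommGroup F] [NormedSpace ℝ F]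
  {N : Type*} [TopologicalSpace N] [ChartedSpace F N]
  {φ : Π x : M, TangentSpace 𝓘(ℝ, E) x →L[ℝ] TangentSpace 𝓘(ℝ, E) x}
  {ζ : Π x : M, TangentSpace 𝓘(ℝ, E) x} {η : Π x : M, TangentSpace 𝓘(ℝ, E) x →L[ℝ] ℝ}
  {Ψ : M → N} {dil : M → ℝ} {D₁ : Π x : M, Submodule ℝ (TangentSpace 𝓘(ℝ, E) x)}
  {W Y Z : Π x : M, TangentSpace 𝓘(ℝ, E) x} {x : M} {v : TangentSpace 𝓘(ℝ, E) x}

theorem IsSection.antiInvariant_vertical (hW : IsSection (antiInvariant F Ψ D₁) W) :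
    IsSection (vertical F Ψ) W := ⟨hW.1, fun x ↦ (hW.2 x).1⟩

theorem IsSection.muReebPerp_horizontal (hY : IsSection (muReebPerp F φ η Ψ D₁) Y) :
    IsSection (horizontal F Ψ) Y := ⟨hY.1, fun x ↦ (hY.2 x).1.1⟩

variable [RiemannianBundle (fun y : N ↦ TangentSpace 𝓘(ℝ, F) y)]

theorem IsAlmostContactMetric.isSection_reeb (hM : IsAlmostContactMetric φ ζ η)
    (hΨ : IsSicReebPerpSubmersion F φ ζ Ψ dil D₁) : IsSection (horizontal F Ψ) ζ :=
  ⟨hM.smooth_reeb, hΨ.reeb_horizontal⟩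

theorem IsAlmostContactMetric.isSection_phi (hM : IsAlmostContactMetric φ ζ η)
    (hΨ : IsSicReebPerpSubmersion F φ ζ Ψ dil D₁) (hW : IsSection (antiInvariant F Ψ D₁) W) :
    IsSection (horizontal F Ψ) (fun x ↦ φ x (W x)) :=
  ⟨hM.isSmoothField_phi hW.1, fun x ↦ hΨ.phi_mem_horizontal (hW.2 x)⟩

variable [FiniteDimensional ℝ E]

theorem IsAlmostContactMetric.isSection_phi_muReebPerp (hM : IsAlmostContactMetric φ ζ η)
    (hΨ : IsSicReebPerpSubmersion F φ ζ Ψ dil D₁) (hY : IsSection (muReebPerp F φ η Ψ D₁) Y) :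
    IsSection (muReebPerp F φ η Ψ D₁) (fun x ↦ φ x (Y x)) :=
  ⟨hM.isSmoothField_phi hY.1, fun x ↦ hM.phi_mem_muReebPerp hΨ (hY.2 x)⟩

theorem IsSicReebPerpSubmersion.exists_isSection_D₁ [T2Space M]
    [IsContMDiffRiemannianBundle 𝓘(ℝ, E) ∞ E (fun x : M ↦ TangentSpace 𝓘(ℝ, E) x)]
    (hΨ : IsSicReebPerpSubmersion F φ ζ Ψ dil D₁) (hv : v ∈ D₁ x) :
    ∃ U, IsSection D₁ U ∧ U x = v :=
  exists_isSection_apply_eq (fun _ ↦ hΨ.smooth_D₁.isSmoothField_starProjection) hv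

variable [IsManifold 𝓘(ℝ, F) ∞ N]
  [IsContMDiffRiemannianBundle 𝓘(ℝ, F) ∞ F (fun y : N ↦ TangentSpace 𝓘(ℝ, F) y)]

-- The Reeb field is horizontal of unit length, so `dil ^ 2` is the squared length of `Ψ_* ζ`.
theorem IsAlmostContactMetric.contMDiff_dil_sq (hM : IsAlmostContactMetric φ ζ η)
    (hΨ : IsSicReebPerpSubmersion F φ ζ Ψ dil D₁) : CMDiff ∞ (fun x ↦ dil x ^ 2) := by
  have hdil x : dil x ^ 2 = inner ℝ (push F Ψ x (ζ x)) (push F Ψ x (ζ x)) := by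
    rw [hΨ.inner_push _ (hΨ.reeb_horizontal x), hM.inner_reeb, hM.eta_reeb, mul_one]
  simp only [hdil]
  exact fun x ↦ contMDiffAt_inner_push (hΨ.smooth x) (hM.smooth_reeb x) (hM.smooth_reeb x)

theorem IsAlmostContactMetric.mdifferentiableAt_dil_sq (hM : IsAlmostContactMetric φ ζ η)
    (hΨ : IsSicReebPerpSubmersion F φ ζ Ψ dil D₁) (x : M) : MDiffAt (fun y ↦ dil y ^ 2) x :=
  (hM.contMDiff_dil_sq hΨ x).mdifferentiableAt (by simp)

variable [IsContMDiffRiemannianBundle 𝓘(ℝ, E) ∞ E (fun x : M ↦ TangentSpace 𝓘(ℝ, E) x)]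

theorem IsAlmostContactMetric.isSection_alphaPart (hM : IsAlmostContactMetric φ ζ η)
    (hΨ : IsSicReebPerpSubmersion F φ ζ Ψ dil D₁) (hZ : IsSmoothField Z) :
    IsSection (antiInvariant F Ψ D₁) (alphaPart F φ Ψ D₁ Z) :=
  ⟨hΨ.isSmoothField_starProjection_antiInvariant (hM.contMDiff_dil_sq hΨ) hΨ.smooth_D₁ hΨ.D₁_le
    (hM.isSmoothField_phi hZ), alphaPart_mem Z⟩

theorem IsAlmostContactMetric.isSection_betaPart (hM : IsAlmostContactMetric φ ζ η)
    (hΨ : IsSicReebPerpSubmersion F φ ζ Ψ dil D₁) (hZ : IsSection (horizontal F Ψ) Z) :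
    IsSection (muReebPerp F φ η Ψ D₁) (betaPart F φ Ψ D₁ Z) := by
  refine ⟨?_, fun x ↦ hM.betaPart_mem hΨ (hZ.2 x)⟩
  have hbeta : betaPart F φ Ψ D₁ Z = fun x ↦ φ x (Z x) - alphaPart F φ Ψ D₁ Z x :=
    funext fun x ↦ eq_sub_of_add_eq' (hM.alphaPart_add_betaPart hΨ (hZ.2 x))
  rw [hbeta]
  exact (hM.isSmoothField_phi hZ.1).sub (hM.isSection_alphaPart hΨ hZ.1).1

variable [T2Space M]

theorem IsAlmostContactMetric.exists_isSection_horizontal (hM : IsAlmostContactMetric φ ζ η)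
    (hΨ : IsSicReebPerpSubmersion F φ ζ Ψ dil D₁) (hv : v ∈ horizontal F Ψ x) :
    ∃ Z, IsSection (horizontal F Ψ) Z ∧ Z x = v :=
  exists_isSection_apply_eq (fun _ ↦ hΨ.isSmoothField_hproj (hM.contMDiff_dil_sq hΨ)) hv

theorem IsAlmostContactMetric.exists_isSection_vertical (hM : IsAlmostContactMetric φ ζ η)
    (hΨ : IsSicReebPerpSubmersion F φ ζ Ψ dil D₁) (hv : v ∈ vertical F Ψ x) :
    ∃ V, IsSection (vertical F Ψ) V ∧ V x = v :=
  exists_isSection_apply_eq (fun _ ↦ hΨ.isSmoothField_vproj (hM.contMDiff_dil_sq hΨ)) hv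

theorem IsAlmostContactMetric.exists_isSection_antiInvariant (hM : IsAlmostContactMetric φ ζ η)
    (hΨ : IsSicReebPerpSubmersion F φ ζ Ψ dil D₁) (hv : v ∈ antiInvariant F Ψ D₁ x) :
    ∃ W, IsSection (antiInvariant F Ψ D₁) W ∧ W x = v :=
  exists_isSection_apply_eq (fun _ ↦ hΨ.isSmoothField_starProjection_antiInvariant
    (hM.contMDiff_dil_sq hΨ) hΨ.smooth_D₁ hΨ.D₁_le) hv

end Sections

section ReebFlow

variable {E : Type*} [NormedAddCommGroup E] [NormedSpace ℝ E]
  {M : Type*} [TopologicalSpace M] [ChartedSpace E M]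
  {φ : Π x : M, TangentSpace 𝓘(ℝ, E) x →L[ℝ] TangentSpace 𝓘(ℝ, E) x}
  {ζ : Π x : M, TangentSpace 𝓘(ℝ, E) x}

/-- The `D₂`-component of `[ζ, W]` for `W ∈ Γ(D₂)`. The remaining component `2 φ W` is the
infinitesimal rotation of `D₂` into `φ D₂` by the flow of `ζ`. -/
noncomputable def reebDeriv (φ : Π x : M, TangentSpace 𝓘(ℝ, E) x →L[ℝ] TangentSpace 𝓘(ℝ, E) x)
    (ζ W : Π x : M, TangentSpace 𝓘(ℝ, E) x) (x : M) : TangentSpace 𝓘(ℝ, E) x :=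
  mlieBracket 𝓘(ℝ, E) ζ W x - (2 : ℝ) • φ x (W x)

theorem reeb_mlieBracket_eq (W : Π x : M, TangentSpace 𝓘(ℝ, E) x) :
    mlieBracket 𝓘(ℝ, E) ζ W = fun x ↦ reebDeriv φ ζ W x + (2 : ℝ) • φ x (W x) :=
  funext fun _ ↦ (sub_add_cancel _ _).symm

variable [FiniteDimensional ℝ E] [IsManifold 𝓘(ℝ, E) ∞ M]
  [RiemannianBundle (fun x : M ↦ TangentSpace 𝓘(ℝ, E) x)]
  [IsContMDiffRiemannianBundle 𝓘(ℝ, E) ∞ E (fun x : M ↦ TangentSpace 𝓘(ℝ, E) x)]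
  {F : Type*} [NormedAddCommGroup F] [NormedSpace ℝ F]
  {N : Type*} [TopologicalSpace N] [ChartedSpace F N]
  [RiemannianBundle (fun y : N ↦ TangentSpace 𝓘(ℝ, F) y)]
  {η : Π x : M, TangentSpace 𝓘(ℝ, E) x →L[ℝ] ℝ} {Ψ : M → N} {dil : M → ℝ}
  {D₁ : Π x : M, Submodule ℝ (TangentSpace 𝓘(ℝ, E) x)}
  {U V W ξ X Y : Π x : M, TangentSpace 𝓘(ℝ, E) x}

theorem IsSasakian.reeb_mlieBracket_phi_eq (hM : IsSasakian φ ζ η)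
    (hΨ : IsSicReebPerpSubmersion F φ ζ Ψ dil D₁) (hW : IsSection (antiInvariant F Ψ D₁) W) :
    mlieBracket 𝓘(ℝ, E) ζ (fun x ↦ φ x (W x)) =
      fun x ↦ φ x (reebDeriv φ ζ W x) + (-2 : ℝ) • W x := by
  funext x
  rw [hM.reeb_mlieBracket_phi hW.1, reeb_mlieBracket_eq (φ := φ), map_add, map_smul,
    hM.phi_phi_of_eta (hM.eta_vertical hΨ (hW.2 x).1), smul_neg, neg_smul]

theorem IsSasakian.inner_nabla_vertical_reeb (hM : IsSasakian φ ζ η)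
    (hΨ : IsSicReebPerpSubmersion F φ ζ Ψ dil D₁) (hV : IsSection (vertical F Ψ) V)
    (hX : IsSmoothField X) (x : M) :
    inner ℝ (nabla X V x) (ζ x) = inner ℝ (V x) (φ x (X x)) := by
  rw [inner_nabla_of_orthogonal hV.1 hM.smooth_reeb
    (fun y ↦ inner_vertical_horizontal (hV.2 y) (hΨ.reeb_horizontal y)), hM.nabla_reeb X hX,
    inner_neg_right, neg_neg]

variable [FiniteDimensional ℝ F] [IsManifold 𝓘(ℝ, F) ∞ N]
  [IsContMDiffRiemannianBundle 𝓘(ℝ, F) ∞ F (fun y : N ↦ TangentSpace 𝓘(ℝ, F) y)]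

theorem IsSasakian.mvfderiv_dil_sq_vertical (hM : IsSasakian φ ζ η)
    (hΨ : IsSicReebPerpSubmersion F φ ζ Ψ dil D₁) (hV : IsSection (vertical F Ψ) V) (x : M) :
    d% (fun y ↦ dil y ^ 2) x (V x) = 0 := by
  have hsymm := hΨ.inner_nabla_vertical_add (hM.mdifferentiableAt_dil_sq hΨ x) hV
    (hM.isSection_reeb hΨ) (hM.isSection_reeb hΨ)
  rw [hM.inner_nabla_vertical_reeb hΨ hV hM.smooth_reeb, hM.phi_reeb, inner_zero_right,
    hM.inner_reeb, hM.eta_reeb] at hsymm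
  linarith

theorem IsSasakian.inner_nabla_vertical_skew (hM : IsSasakian φ ζ η)
    (hΨ : IsSicReebPerpSubmersion F φ ζ Ψ dil D₁) (hV : IsSection (vertical F Ψ) V)
    (hX : IsSection (horizontal F Ψ) X) (hY : IsSection (horizontal F Ψ) Y) (x : M) :
    inner ℝ (nabla X V x) (Y x) = -inner ℝ (nabla Y V x) (X x) := by
  have hsymm := hΨ.inner_nabla_vertical_add (hM.mdifferentiableAt_dil_sq hΨ x) hV hX hY
  rw [hM.mvfderiv_dil_sq_vertical hΨ hV, zero_mul, neg_zero] at hsymm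
  exact eq_neg_of_add_eq_zero_left
    ((mul_eq_zero.1 hsymm).resolve_left (pow_ne_zero 2 (hΨ.dil_pos x).ne'))

variable [T2Space M]

theorem IsSasakian.inner_reeb_mlieBracket_vertical (hM : IsSasakian φ ζ η)
    (hΨ : IsSicReebPerpSubmersion F φ ζ Ψ dil D₁) (hV : IsSection (vertical F Ψ) V) {x : M}
    {y : TangentSpace 𝓘(ℝ, E) x} (hy : y ∈ horizontal F Ψ x) :
    inner ℝ (mlieBracket 𝓘(ℝ, E) ζ V x) y = 2 * inner ℝ (φ x (V x)) y := by
  obtain ⟨Y, hY, rfl⟩ := hM.exists_isSection_horizontal hΨ hy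
  rw [hM.reeb_mlieBracket hV.1, inner_add_left,
    hM.inner_nabla_vertical_skew hΨ hV (hM.isSection_reeb hΨ) hY,
    hM.inner_nabla_vertical_reeb hΨ hV hY.1, hM.inner_phi]
  ring

theorem IsSasakian.reeb_mlieBracket_mem_D₁ (hM : IsSasakian φ ζ η)
    (hΨ : IsSicReebPerpSubmersion F φ ζ Ψ dil D₁) (hU : IsSection D₁ U) (x : M) :
    mlieBracket 𝓘(ℝ, E) ζ U x ∈ D₁ x := by
  have hvert {U} (hU : IsSection D₁ U) : mlieBracket 𝓘(ℝ, E) ζ U x ∈ vertical F Ψ x := by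
    refine mem_vertical_of_inner fun y hy ↦ ?_
    rw [hM.inner_reeb_mlieBracket_vertical hΨ ⟨hU.1, fun x ↦ hΨ.D₁_le x (hU.2 x)⟩ hy,
      inner_vertical_horizontal (hΨ.D₁_le x (hΨ.phi_mem_D₁ (hU.2 x))) hy, mul_zero]
  refine mem_D₁_of_inner (hΨ.D₁_le x) (hvert hU) fun w hw ↦ ?_
  have hvert_phi := hvert ⟨hM.isSmoothField_phi hU.1, fun x ↦ hΨ.phi_mem_D₁ (hU.2 x)⟩
  rw [← hM.inner_phi_phi_of_eta (hM.eta_vertical hΨ hw.1), ← hM.reeb_mlieBracket_phi hU.1,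
    inner_vertical_horizontal hvert_phi (hΨ.phi_mem_horizontal hw)]

theorem IsSasakian.isSection_reebDeriv (hM : IsSasakian φ ζ η)
    (hΨ : IsSicReebPerpSubmersion F φ ζ Ψ dil D₁) (hW : IsSection (antiInvariant F Ψ D₁) W) :
    IsSection (antiInvariant F Ψ D₁) (reebDeriv φ ζ W) := by
  have := FiniteDimensional.complete ℝ E
  refine ⟨(hM.smooth_reeb.mlieBracket hW.1).sub ((hM.isSmoothField_phi hW.1).const_smul 2),
    fun x ↦ mem_antiInvariant_of_inner ?_ ?_⟩
  · intro y hy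
    rw [reebDeriv, inner_sub_left, real_inner_smul_left,
      hM.inner_reeb_mlieBracket_vertical hΨ hW.antiInvariant_vertical hy, sub_self]
  · intro u hu
    obtain ⟨U, hU, rfl⟩ := hΨ.exists_isSection_D₁ hu
    rw [reebDeriv, inner_sub_left, real_inner_smul_left,
      hM.isKillingField_reeb.inner_mlieBracket_of_orthogonal hW.1 hU.1
        (fun y ↦ inner_antiInvariant_D₁ (hW.2 y) (hU.2 y)),
      inner_antiInvariant_D₁ (hW.2 x) (hM.reeb_mlieBracket_mem_D₁ hΨ hU x),
      inner_horizontal_vertical (hΨ.phi_mem_horizontal (hW.2 x)) (hΨ.D₁_le x (hU.2 x))]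
    simp

theorem IsSasakian.isSection_reeb_mlieBracket_muReebPerp (hM : IsSasakian φ ζ η)
    (hΨ : IsSicReebPerpSubmersion F φ ζ Ψ dil D₁) (hY : IsSection (muReebPerp F φ η Ψ D₁) Y) :
    IsSection (muReebPerp F φ η Ψ D₁) (mlieBracket 𝓘(ℝ, E) ζ Y) := by
  have := FiniteDimensional.complete ℝ E
  have hskew {Q} (hQ : IsSmoothField Q) (horth : ∀ y, inner ℝ (Y y) (Q y) = 0) (x : M) :
      inner ℝ (mlieBracket 𝓘(ℝ, E) ζ Y x) (Q x) = -inner ℝ (Y x) (mlieBracket 𝓘(ℝ, E) ζ Q x) :=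
    hM.isKillingField_reeb.inner_mlieBracket_of_orthogonal hY.1 hQ horth x
  refine ⟨hM.smooth_reeb.mlieBracket hY.1, fun x ↦
    ⟨mem_muDist_of_inner (mem_horizontal_of_inner fun v hv ↦ ?_) fun w hw ↦ ?_, ?_⟩⟩
  · obtain ⟨V, hV, rfl⟩ := hM.exists_isSection_vertical hΨ hv
    rw [hskew hV.1 (fun y ↦ inner_horizontal_vertical (hY.2 y).1.1 (hV.2 y)), real_inner_comm,
      hM.inner_reeb_mlieBracket_vertical hΨ hV (hY.2 x).1.1, hM.inner_phi,
      inner_vertical_horizontal hv (hM.phi_mem_muReebPerp hΨ (hY.2 x)).1.1]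
    simp
  · obtain ⟨W, hW, rfl⟩ := hM.exists_isSection_antiInvariant hΨ hw
    rw [hskew (hM.isSmoothField_phi hW.1) (fun y ↦ inner_muDist_phi (hY.2 y).1 (hW.2 y)),
      hM.reeb_mlieBracket_phi_eq hΨ hW, inner_add_right, real_inner_smul_right,
      inner_muDist_phi (hY.2 x).1 ((hM.isSection_reebDeriv hΨ hW).2 x),
      inner_horizontal_vertical (hY.2 x).1.1 hw.1]
    simp
  · change η x _ = 0
    rw [← hM.inner_reeb, hskew hM.smooth_reeb (fun y ↦ (hM.inner_reeb y _).trans (hY.2 y).2)]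
    simp

-- Differentiate `⟪∇_{φ ξ} W, Y⟫ = 0` along the Killing field `ζ`: the rotation of `φ ξ` into
-- `D₂` produces `⟪∇_ξ W, Y⟫`, and every other term vanishes by hypothesis.
theorem IsSasakian.inner_nabla_eq_zero_of_inner_nabla_phi (hM : IsSasakian φ ζ η)
    (hΨ : IsSicReebPerpSubmersion F φ ζ Ψ dil D₁)
    (hzero : ∀ W ξ Y, IsSection (antiInvariant F Ψ D₁) W → IsSection (antiInvariant F Ψ D₁) ξ →
      IsSection (muReebPerp F φ η Ψ D₁) Y → ∀ x,
        inner ℝ (nabla (fun y ↦ φ y (ξ y)) W x) (Y x) = 0)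
    (hW : IsSection (antiInvariant F Ψ D₁) W) (hξ : IsSection (antiInvariant F Ψ D₁) ξ)
    (hY : IsSection (muReebPerp F φ η Ψ D₁) Y) (x : M) : inner ℝ (nabla W ξ x) (Y x) = 0 := by
  have hδW := hM.isSection_reebDeriv hΨ hW
  have hδξ := hM.isSection_reebDeriv hΨ hξ
  have hLie := hM.isKillingField_reeb.mvfderiv_inner_nabla (hM.isSmoothField_phi hW.1) hξ.1 hY.1 x
  have hphi : inner ℝ (nabla (fun y ↦ φ y (W y)) (fun y ↦ φ y (ξ y)) x) (Y x) = 0 := by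
    rw [hM.inner_nabla_phi (hM.isSmoothField_phi hW.1) hξ.1 (hM.eta_vertical hΨ (hξ.2 x).1)
      (hY.2 x).2, hzero ξ W _ hξ hW (hM.isSection_phi_muReebPerp hΨ hY), neg_zero]
  rw [funext (hzero ξ W Y hξ hW hY), hM.reeb_mlieBracket_phi_eq hΨ hW,
    reeb_mlieBracket_eq (φ := φ) ξ, nabla_add_smul_left,
    nabla_add_smul_right _ _ hδξ.1 (hM.isSmoothField_phi hξ.1), inner_add_left, inner_add_left,
    real_inner_smul_left, real_inner_smul_left, hphi, hzero ξ _ Y hξ hδW hY,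
    hzero _ W Y hδξ hW hY,
    hzero ξ W _ hξ hW (hM.isSection_reeb_mlieBracket_muReebPerp hΨ hY), mvfderiv_const] at hLie
  simp only [zero_apply] at hLie
  linarith

theorem IsSasakian.inner_nabla_phi_eq_zero_of_inner_nabla (hM : IsSasakian φ ζ η)
    (hΨ : IsSicReebPerpSubmersion F φ ζ Ψ dil D₁)
    (hzero : ∀ W ξ Y, IsSection (antiInvariant F Ψ D₁) W → IsSection (antiInvariant F Ψ D₁) ξ →
      IsSection (muReebPerp F φ η Ψ D₁) Y → ∀ x, inner ℝ (nabla W ξ x) (Y x) = 0)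
    (hW : IsSection (antiInvariant F Ψ D₁) W) (hξ : IsSection (antiInvariant F Ψ D₁) ξ)
    (hY : IsSection (muReebPerp F φ η Ψ D₁) Y) (x : M) :
    inner ℝ (nabla (fun y ↦ φ y (ξ y)) W x) (Y x) = 0 := by
  have hδW := hM.isSection_reebDeriv hΨ hW
  have hδξ := hM.isSection_reebDeriv hΨ hξ
  have hLie := hM.isKillingField_reeb.mvfderiv_inner_nabla hξ.1 hW.1 hY.1 x
  have hphi : inner ℝ (nabla ξ (fun y ↦ φ y (W y)) x) (Y x) = 0 := by
    rw [hM.inner_nabla_phi hξ.1 hW.1 (hM.eta_vertical hΨ (hW.2 x).1) (hY.2 x).2,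
      hzero ξ W _ hξ hW (hM.isSection_phi_muReebPerp hΨ hY), neg_zero]
  rw [funext (hzero ξ W Y hξ hW hY), reeb_mlieBracket_eq (φ := φ) ξ,
    reeb_mlieBracket_eq (φ := φ) W, nabla_add_smul_left,
    nabla_add_smul_right _ _ hδW.1 (hM.isSmoothField_phi hW.1), inner_add_left, inner_add_left,
    real_inner_smul_left, real_inner_smul_left, hphi, hzero _ W Y hδξ hW hY,
    hzero ξ _ Y hξ hδW hY,
    hzero ξ W _ hξ hW (hM.isSection_reeb_mlieBracket_muReebPerp hΨ hY), mvfderiv_const] at hLie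
  simp only [zero_apply] at hLie
  linarith

end ReebFlow

section Conditions

variable {E : Type*} [NormedAddCommGroup E] [NormedSpace ℝ E] [FiniteDimensional ℝ E]
  {M : Type*} [TopologicalSpace M] [ChartedSpace E M] [IsManifold 𝓘(ℝ, E) ∞ M]
  [RiemannianBundle (fun x : M ↦ TangentSpace 𝓘(ℝ, E) x)]
  {F : Type*} [NormedAddCommGroup F] [NormedSpace ℝ F]
  {N : Type*} [TopologicalSpace N] [ChartedSpace F N]
  {φ : Π x : M, TangentSpace 𝓘(ℝ, E) x →L[ℝ] TangentSpace 𝓘(ℝ, E) x}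
  {ζ : Π x : M, TangentSpace 𝓘(ℝ, E) x} {η : Π x : M, TangentSpace 𝓘(ℝ, E) x →L[ℝ] ℝ}
  {Ψ : M → N} {dil : M → ℝ} {D₁ : Π x : M, Submodule ℝ (TangentSpace 𝓘(ℝ, E) x)}
  {A U W X Y Z ξ : Π x : M, TangentSpace 𝓘(ℝ, E) x}

theorem IsAlmostContactMetric.alphaPart_phi (hM : IsAlmostContactMetric φ ζ η) {x : M}
    (hY : Y x ∈ muReebPerp F φ η Ψ D₁ x) : alphaPart F φ Ψ D₁ (fun y ↦ φ y (Y y)) x = 0 := by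
  rw [alphaPart, hM.phi_phi_of_eta hY.2, Submodule.starProjection_apply_eq_zero_iff]
  exact neg_mem ((Submodule.mem_orthogonal' _ _).2 fun v hv ↦
    inner_horizontal_vertical hY.1.1 hv.1)

theorem IsAlmostContactMetric.betaPart_phi (hM : IsAlmostContactMetric φ ζ η) {x : M}
    (hY : Y x ∈ muReebPerp F φ η Ψ D₁ x) :
    betaPart F φ Ψ D₁ (fun y ↦ φ y (Y y)) x = -Y x := by
  rw [betaPart, hM.phi_phi_of_eta hY.2]
  exact Submodule.starProjection_eq_self_iff.2 (neg_mem hY.1)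

variable [IsContMDiffRiemannianBundle 𝓘(ℝ, E) ∞ E (fun x : M ↦ TangentSpace 𝓘(ℝ, E) x)]

theorem definesTotallyGeodesicFoliation_iff {D : Π x : M, Submodule ℝ (TangentSpace 𝓘(ℝ, E) x)} :
    DefinesTotallyGeodesicFoliation D ↔
      ∀ X Y, IsSection D X → IsSection D Y → ∀ x, nabla X Y x ∈ D x := by
  refine ⟨And.right, fun h ↦ ⟨fun X Y hX hY x ↦ ?_, h⟩⟩
  rw [mlieBracket_eq_nabla hX.1 hY.1]
  exact sub_mem (h X Y hX hY x) (h Y X hY hX x)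

variable [RiemannianBundle (fun y : N ↦ TangentSpace 𝓘(ℝ, F) y)]

theorem IsSasakian.inner_nabla_phi_D₁ (hM : IsSasakian φ ζ η)
    (hΨ : IsSicReebPerpSubmersion F φ ζ Ψ dil D₁) (hX : IsSmoothField X)
    (hξ : IsSection (antiInvariant F Ψ D₁) ξ) (hU : IsSection D₁ U) (x : M) :
    inner ℝ (nabla X (fun y ↦ φ y (U y)) x) (φ x (ξ x)) = -inner ℝ (nabla X ξ x) (U x) := by
  rw [hM.inner_nabla_phi_phi hX hU.1 (hM.eta_vertical hΨ (hΨ.D₁_le x (hU.2 x)))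
    (hM.eta_vertical hΨ (hξ.2 x).1), inner_nabla_of_orthogonal hξ.1 hU.1
    (fun y ↦ inner_antiInvariant_D₁ (hξ.2 y) (hU.2 y)), neg_neg, real_inner_comm]

theorem IsSasakian.inner_phi_oneillT (hM : IsSasakian φ ζ η)
    (hΨ : IsSicReebPerpSubmersion F φ ζ Ψ dil D₁) (hW : IsSection (vertical F Ψ) W)
    (hξ : IsSection (antiInvariant F Ψ D₁) ξ) (hA : IsSection (vertical F Ψ) A) (x : M) :
    inner ℝ (φ x (ξ x)) (oneillT F Ψ W A x) = inner ℝ (nabla W ξ x) (φ x (A x)) := by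
  have hvproj {V : Π x : M, TangentSpace 𝓘(ℝ, E) x} (hV : IsSection (vertical F Ψ) V) :
      (fun y ↦ vproj F Ψ y (V y)) = V :=
    funext fun y ↦ Submodule.starProjection_eq_self_iff.2 (hV.2 y)
  have hφξ := hM.isSection_phi hΨ hξ
  have hleibniz := inner_nabla_of_orthogonal hφξ.1 hA.1
    (fun y ↦ inner_horizontal_vertical (hφξ.2 y) (hA.2 y)) W x
  have hphi := hM.inner_nabla_phi hW.1 hξ.1 (hM.eta_vertical hΨ (hξ.2 x).1)
    (hM.eta_vertical hΨ (hA.2 x))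
  rw [oneillT, hvproj hW, hvproj hA, inner_add_right,
    inner_horizontal_vertical (hφξ.2 x) (vproj_mem x _), add_zero, real_inner_comm,
    inner_hproj_left _ (hφξ.2 x), real_inner_comm]
  linarith

variable [IsManifold 𝓘(ℝ, F) ∞ N]
  [IsContMDiffRiemannianBundle 𝓘(ℝ, F) ∞ F (fun y : N ↦ TangentSpace 𝓘(ℝ, F) y)]

theorem IsSasakian.inner_nabla_horizontal (hM : IsSasakian φ ζ η)
    (hΨ : IsSicReebPerpSubmersion F φ ζ Ψ dil D₁) (hW : IsSection (antiInvariant F Ψ D₁) W)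
    (hξ : IsSection (antiInvariant F Ψ D₁) ξ) (hZ : IsSection (horizontal F Ψ) Z) (x : M) :
    inner ℝ (nabla W ξ x) (Z x) =
      -inner ℝ (φ x (ξ x)) (oneillT F Ψ W (alphaPart F φ Ψ D₁ Z) x) -
        inner ℝ (nabla W ξ x) (φ x (betaPart F φ Ψ D₁ Z x)) := by
  have hreeb : inner ℝ (nabla W ξ x) (ζ x) = 0 := by
    rw [hM.inner_nabla_vertical_reeb hΨ hξ.antiInvariant_vertical hW.1,
      inner_vertical_horizontal (hξ.2 x).1 (hΨ.phi_mem_horizontal (hW.2 x))]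
  rw [hM.inner_phi_oneillT hΨ hW.antiInvariant_vertical hξ
      (hM.isSection_alphaPart hΨ hZ.1).antiInvariant_vertical,
    eq_sub_of_add_eq' (hM.alphaPart_add_betaPart hΨ (hZ.2 x)), map_sub, inner_sub_right,
    hM.phi_phi, inner_add_right, inner_neg_right, real_inner_smul_right, hreeb]
  ring

theorem IsSasakian.definesTotallyGeodesicFoliation_antiInvariant_iff [T2Space M]
    (hM : IsSasakian φ ζ η)
    (hΨ : IsSicReebPerpSubmersion F φ ζ Ψ dil D₁) :
    DefinesTotallyGeodesicFoliation (antiInvariant F Ψ D₁) ↔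
      (∀ W ξ U, IsSection (antiInvariant F Ψ D₁) W → IsSection (antiInvariant F Ψ D₁) ξ →
        IsSection D₁ U → ∀ x, inner ℝ (nabla W ξ x) (U x) = 0) ∧
      (∀ W ξ Z, IsSection (antiInvariant F Ψ D₁) W → IsSection (antiInvariant F Ψ D₁) ξ →
        IsSection (horizontal F Ψ) Z → ∀ x, inner ℝ (nabla W ξ x) (Z x) = 0) := by
  rw [definesTotallyGeodesicFoliation_iff]
  constructor
  · intro h
    exact ⟨fun W ξ U hW hξ hU x ↦ inner_antiInvariant_D₁ (h W ξ hW hξ x) (hU.2 x),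
      fun W ξ Z hW hξ hZ x ↦ inner_vertical_horizontal (h W ξ hW hξ x).1 (hZ.2 x)⟩
  · rintro ⟨hD₁, hhor⟩ W ξ hW hξ x
    refine mem_antiInvariant_of_inner (fun z hz ↦ ?_) fun u hu ↦ ?_
    · obtain ⟨Z, hZ, rfl⟩ := hM.exists_isSection_horizontal hΨ hz
      exact hhor W ξ Z hW hξ hZ x
    · obtain ⟨U, hU, rfl⟩ := hΨ.exists_isSection_D₁ hu
      exact hD₁ W ξ U hW hξ hU x

variable [FiniteDimensional ℝ F]

theorem IsSasakian.inner_pullbackNabla_phi (hM : IsSasakian φ ζ η)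
    (hΨ : IsSicReebPerpSubmersion F φ ζ Ψ dil D₁) (hW : IsSection (antiInvariant F Ψ D₁) W)
    (hξ : IsSection (antiInvariant F Ψ D₁) ξ) (hY : IsSection (muReebPerp F φ η Ψ D₁) Y) (x : M) :
    1 / dil x ^ 2 *
        inner ℝ (pullbackNabla F Ψ (fun y ↦ φ y (ξ y)) (fun y ↦ push F Ψ y (φ y (W y))) x)
          (push F Ψ x (φ x (Y x))) =
      inner ℝ (nabla (fun y ↦ φ y (ξ y)) W x) (Y x) -
        inner ℝ (W x) (ξ x) *
          inner ℝ (hproj F Ψ x (grad (fun y ↦ Real.log (dil y)) x)) (φ x (Y x)) := by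
  have hd : dil x ≠ 0 := (hΨ.dil_pos x).ne'
  have hdil := hM.mdifferentiableAt_dil_sq hΨ x
  have hφY := hM.isSection_phi_muReebPerp hΨ hY
  rw [hΨ.inner_pullbackNabla hdil (hM.isSection_phi hΨ hξ) (hM.isSection_phi hΨ hW)
      hφY.muReebPerp_horizontal,
    real_inner_comm _ (φ x (W x)), inner_muDist_phi (hφY.2 x).1 (hW.2 x),
    real_inner_comm (φ x (Y x)) (φ x (ξ x)), inner_muDist_phi (hφY.2 x).1 (hξ.2 x),
    hM.inner_phi_phi_of_eta (hM.eta_vertical hΨ (hW.2 x).1),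
    hM.inner_nabla_phi_phi (hM.isSmoothField_phi hξ.1) hW.1 (hM.eta_vertical hΨ (hW.2 x).1)
      (hY.2 x).2, mvfderiv_sq_eq_mul_mvfderiv_log hdil hd (φ x (Y x)),
    inner_hproj_left _ (hφY.2 x).1.1, grad, inner_sharp, real_inner_comm (W x)]
  field_simp
  ring

theorem IsSasakian.inner_pullbackNabla_phi_eq_iff (hM : IsSasakian φ ζ η)
    (hΨ : IsSicReebPerpSubmersion F φ ζ Ψ dil D₁) (hW : IsSection (antiInvariant F Ψ D₁) W)
    (hξ : IsSection (antiInvariant F Ψ D₁) ξ) (hY : IsSection (muReebPerp F φ η Ψ D₁) Y) (x : M)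
    (c : ℝ) :
    1 / dil x ^ 2 *
        inner ℝ (pullbackNabla F Ψ (fun y ↦ φ y (ξ y)) (fun y ↦ push F Ψ y (φ y (W y))) x)
          (push F Ψ x (φ x (Y x))) =
      c - inner ℝ (W x) (ξ x) *
            inner ℝ (hproj F Ψ x (grad (fun y ↦ Real.log (dil y)) x)) (φ x (Y x))
        + η x (Y x) * inner ℝ (W x) (ξ x) ↔
    inner ℝ (nabla (fun y ↦ φ y (ξ y)) W x) (Y x) = c := by
  have hη : η x (Y x) = 0 := (hY.2 x).2
  rw [hM.inner_pullbackNabla_phi hΨ hW hξ hY, hη, zero_mul, add_zero, sub_left_inj]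

variable [T2Space M]

theorem IsSasakian.secondFundamentalForm_mem_iff (hM : IsSasakian φ ζ η)
    (hΨ : IsSicReebPerpSubmersion F φ ζ Ψ dil D₁) (hX : IsSmoothField X)
    (hU : IsSection D₁ U) (x : M) :
    secondFundamentalForm F Ψ X (fun y ↦ φ y (U y)) x ∈
        (muDist F φ Ψ D₁ x).map (push F Ψ x).toLinearMap ↔
      ∀ ξ, IsSection (antiInvariant F Ψ D₁) ξ → inner ℝ (nabla X ξ x) (U x) = 0 := by
  have hsff : secondFundamentalForm F Ψ X (fun y ↦ φ y (U y)) x =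
      -push F Ψ x (nabla X (fun y ↦ φ y (U y)) x) := by
    rw [secondFundamentalForm,
      pullbackNabla_push_vertical ((hΨ.smooth x).mdifferentiableAt (by simp))
        (fun y ↦ hΨ.D₁_le y (hΨ.phi_mem_D₁ (hU.2 y))), zero_sub]
  rw [hsff]
  constructor
  · rintro ⟨m, hm, hpush : push F Ψ x m = _⟩ ξ hξ
    have hconf := hΨ.inner_push m (hΨ.phi_mem_horizontal (hξ.2 x))
    rw [hpush, inner_neg_left, hΨ.inner_push _ (hΨ.phi_mem_horizontal (hξ.2 x)),
      inner_muDist_phi hm (hξ.2 x), hM.inner_nabla_phi_D₁ hΨ hX hξ hU] at hconf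
    simpa [(hΨ.dil_pos x).ne'] using hconf
  · intro h
    refine ⟨-hproj F Ψ x (nabla X (fun y ↦ φ y (U y)) x), neg_mem (mem_muDist_of_inner
      (hproj_mem x _) fun w hw ↦ ?_), (map_neg _ _).trans (congrArg Neg.neg (push_hproj x _))⟩
    obtain ⟨ξ, hξ, rfl⟩ := hM.exists_isSection_antiInvariant hΨ hw
    rw [inner_hproj_left _ (hΨ.phi_mem_horizontal hw), hM.inner_nabla_phi_D₁ hΨ hX hξ hU, h ξ hξ,
      neg_zero]

theorem IsSasakian.forall_inner_nabla_horizontal_eq_zero_iff (hM : IsSasakian φ ζ η)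
    (hΨ : IsSicReebPerpSubmersion F φ ζ Ψ dil D₁) :
    (∀ W ξ Z, IsSection (antiInvariant F Ψ D₁) W → IsSection (antiInvariant F Ψ D₁) ξ →
        IsSection (horizontal F Ψ) Z → ∀ x, inner ℝ (nabla W ξ x) (Z x) = 0) ↔
      ∀ W ξ Z, IsSection (antiInvariant F Ψ D₁) W → IsSection (antiInvariant F Ψ D₁) ξ →
        IsSection (horizontal F Ψ) Z → ∀ x,
          inner ℝ (nabla (fun y ↦ φ y (ξ y)) W x) (betaPart F φ Ψ D₁ Z x) =
            inner ℝ (φ x (ξ x)) (oneillT F Ψ W (alphaPart F φ Ψ D₁ Z) x) := by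
  constructor
  · intro h W ξ Z hW hξ hZ x
    have hβ := hM.isSection_betaPart hΨ hZ
    have hφβ := (hM.isSection_phi_muReebPerp hΨ hβ).muReebPerp_horizontal
    have hsplit := hM.inner_nabla_horizontal hΨ hW hξ hZ x
    rw [h W ξ Z hW hξ hZ, h W ξ _ hW hξ hφβ] at hsplit
    rw [hM.inner_nabla_phi_eq_zero_of_inner_nabla hΨ
      (fun W ξ Y hW hξ hY ↦ h W ξ Y hW hξ hY.muReebPerp_horizontal) hW hξ hβ]
    linarith
  · intro h
    -- Take `Z = φ Y`, for which `α Z = 0` and `β Z = -Y`.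
    have hzero W ξ Y (hW : IsSection (antiInvariant F Ψ D₁) W)
        (hξ : IsSection (antiInvariant F Ψ D₁) ξ) (hY : IsSection (muReebPerp F φ η Ψ D₁) Y) x :
        inner ℝ (nabla (fun y ↦ φ y (ξ y)) W x) (Y x) = 0 := by
      have hφY := (hM.isSection_phi_muReebPerp hΨ hY).muReebPerp_horizontal
      have hT := h W ξ _ hW hξ hφY x
      rwa [hM.inner_phi_oneillT hΨ hW.antiInvariant_vertical hξ
          (hM.isSection_alphaPart hΨ hφY.1).antiInvariant_vertical, hM.alphaPart_phi (hY.2 x),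
        hM.betaPart_phi (hY.2 x), map_zero, inner_zero_right, inner_neg_right,
        neg_eq_zero] at hT
    intro W ξ Z hW hξ hZ x
    have hβ := hM.isSection_betaPart hΨ hZ
    rw [hM.inner_nabla_horizontal hΨ hW hξ hZ, ← h W ξ Z hW hξ hZ, hzero W ξ _ hW hξ hβ,
      hM.inner_nabla_eq_zero_of_inner_nabla_phi hΨ hzero hW hξ (hM.isSection_phi_muReebPerp hΨ hβ),
      neg_zero, sub_zero]

end Conditions

end SicSubmersion

theorem mainTheorem10
    {E : Type*} [NormedAddCommGroup E] [NormedSpace ℝ E] [FiniteDimensional ℝ E]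
    {M : Type*} [TopologicalSpace M] [T2Space M] [SecondCountableTopology M]
    [ChartedSpace E M] [IsManifold 𝓘(ℝ, E) ∞ M]
    [RiemannianBundle (fun x : M ↦ TangentSpace 𝓘(ℝ, E) x)]
    [IsContMDiffRiemannianBundle 𝓘(ℝ, E) ∞ E (fun x : M ↦ TangentSpace 𝓘(ℝ, E) x)]
    {F : Type*} [NormedAddCommGroup F] [NormedSpace ℝ F] [FiniteDimensional ℝ F]
    {N : Type*} [TopologicalSpace N] [T2Space N] [SecondCountableTopology N]
    [ChartedSpace F N] [IsManifold 𝓘(ℝ, F) ∞ N]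
    [RiemannianBundle (fun y : N ↦ TangentSpace 𝓘(ℝ, F) y)]
    [IsContMDiffRiemannianBundle 𝓘(ℝ, F) ∞ F (fun y : N ↦ TangentSpace 𝓘(ℝ, F) y)]
    (φ : Π x : M, TangentSpace 𝓘(ℝ, E) x →L[ℝ] TangentSpace 𝓘(ℝ, E) x)
    (ζ : Π x : M, TangentSpace 𝓘(ℝ, E) x)
    (η : Π x : M, TangentSpace 𝓘(ℝ, E) x →L[ℝ] ℝ)
    (hM : IsSasakian φ ζ η)
    (Ψ : M → N) (dil : M → ℝ) (D₁ : Π x : M, Submodule ℝ (TangentSpace 𝓘(ℝ, E) x))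
    (hΨ : IsSicReebPerpSubmersion F φ ζ Ψ dil D₁) :
    DefinesTotallyGeodesicFoliation (antiInvariant F Ψ D₁) ↔
      (∀ W U : Π x : M, TangentSpace 𝓘(ℝ, E) x,
        IsSection (antiInvariant F Ψ D₁) W → IsSection D₁ U → ∀ x,
          secondFundamentalForm F Ψ W (fun y ↦ φ y (U y)) x ∈
            (muDist F φ Ψ D₁ x).map (push F Ψ x).toLinearMap) ∧
      (∀ W ξ Z : Π x : M, TangentSpace 𝓘(ℝ, E) x,
        IsSection (antiInvariant F Ψ D₁) W → IsSection (antiInvariant F Ψ D₁) ξ →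
        IsSection (horizontal F Ψ) Z → ∀ x,
          1 / dil x ^ 2 *
              inner ℝ
                (pullbackNabla F Ψ (fun y ↦ φ y (ξ y)) (fun y ↦ push F Ψ y (φ y (W y))) x)
                (push F Ψ x (φ x (betaPart F φ Ψ D₁ Z x))) =
            inner ℝ (φ x (ξ x)) (oneillT F Ψ W (alphaPart F φ Ψ D₁ Z) x)
              - inner ℝ (W x) (ξ x) *
                  inner ℝ (hproj F Ψ x (grad (fun y ↦ Real.log (dil y)) x))
                    (φ x (betaPart F φ Ψ D₁ Z x))
              + η x (betaPart F φ Ψ D₁ Z x) * inner ℝ (W x) (ξ x)) := by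
  rw [hM.definesTotallyGeodesicFoliation_antiInvariant_iff hΨ,
    hM.forall_inner_nabla_horizontal_eq_zero_iff hΨ]
  refine and_congr ⟨fun h W U hW hU x ↦ ?_, fun h W ξ U hW hξ hU x ↦ ?_⟩
    (forall₃_congr fun W ξ Z ↦ forall₄_congr fun hW hξ hZ x ↦ ?_)
  · exact (hM.secondFundamentalForm_mem_iff hΨ hW.1 hU x).2 fun ξ hξ ↦ h W ξ U hW hξ hU x
  · exact (hM.secondFundamentalForm_mem_iff hΨ hW.1 hU x).1 (h W U hW hU x) ξ hξ
  · exact (hM.inner_pullbackNabla_phi_eq_iff hΨ hW hξ (hM.isSection_betaPart hΨ hZ) x _).symm
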